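/- Let $k \le n$ be positive integers. A Fubini word $w=w_1\cdots w_n\in\mathcal W_{n,k}$ is a surjective map $w:[n]\to[k]$. For $i\in[k]$ let $\alpha_i(w)$ be the position of the first letter $i$ in $w$; for $J\subseteq[n]$ let $\alpha_J(w)$ be the multiset $\{\alpha_{w(j)}(w) : j\in J\}$. Put $\mathrm{in}(w)=\{\alpha_1(w),\dots,\alpha_k(w)\}$. For finite multisets of integers of equal size, $A\trianglelefteq B$ (Gale order) means that $a_i\le b_i$ for all $i$ when $A=\{a_1\le a_2\le\cdots\}$ and $B=\{b_1\le b_2\le\cdots\}$. Let $X_{n,k}$ be the set of $n$-tuples of lines through the origin (points of $\mathbb P^{k-1}$) in $\mathbb C^k$ whose sum is $\mathbb C^k$, with the Zariski topology as a subspace of $(\mathbb P^{k-1})^n$. Let $P_w$ be the set of complex $k\times n$ matrices whose entry in position $(w_j,j)$ is $1$ for each $j\in[n]$, whose entry in position $(w_i,j)$ is arbitrary whenever $i\in\mathrm{in}(w)$, $i<\alpha_{w(j)}(w)$ and either $j\in\mathrm{in}(w)$ and $w_i<w_j$, or $j\notin\mathrm{in}(w)$, and whose other entries are all $0$. Let $U$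 be the group of lower unitriangular complex $k\times k$ matrices, let $C_w\subseteq X_{n,k}$ be the set of tuples of lines spanned by the columns of the matrices in $UP_w$, and let $\overline{C}_w$ be the closure of $C_w$ in $X_{n,k}$. Write $v\le w$ (medium roast Fubini–Bruhat order) if $C_w\subseteq\overline{C}_v$, and $v\rightharpoonup w$ ($C_v$ touches $C_w$) if $\overline{C}_v\cap C_w\ne\emptyset$. Let $v,w\in\mathcal W_{n,k}$. Then: 1. $v\le w$ if and only if, for every $J\subseteq[n]$ with $1\le |J|=h\le k$ such that $\{\alpha_1(w),\dots,\alpha_h(w)\}\trianglelefteq\alpha_J(w)$, also $\{\alpha_1(v),\dots,\alpha_h(v)\}\trianglelefteq\alpha_J(v)$. 2. $v\rightharpoonup w$ if and only if, for every $J\subseteq[n]$ with $1\le |J|=h\le k$ such that $\{\alpha_1(w),\dots,\alpha_h(w)\}=\alpha_J(w)$ as multisets, also $\{\alpha_1(v),\dots,\alpha_h(v)\}\trianglelefteq\alpha_J(v)$. 3. If $v\le w$ or $v\rightharpoonup w$, then $\{\alpha_1(v),\dots,\alpha_h(v)\}\trianglelefteq\{\alpha_1(w),\dots,\alpha_h(w)\}$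 for all $1\le h\le k$. This generalizes the Ehresmann Criterion: if $n=k$, then $v\le w$ if and only if $\{\alpha_1(v),\dots,\alpha_h(v)\}\trianglelefteq\{\alpha_1(w),\dots,\alpha_h(w)\}$ for all $1\le h\le k$. -/

import Mathlib

open scoped LinearAlgebra.Projectivization

noncomputable section

/-- Fubini words of length `n` on the alphabet `[k]`: surjective maps `[n] → [k]`.
Positions and letters are indexed from `0`. -/
abbrev FubiniWord (n k : ℕ) : Type := {w : Fin n → Fin k // Function.Surjective w}

namespace FubiniWord

variable {n k : ℕ}

/-- The set of positions of the letter `i` in `w`. -/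
def positions (w : FubiniWord n k) (i : Fin k) : Finset (Fin n) :=
  Finset.univ.filter fun j => w.1 j = i

theorem positions_nonempty (w : FubiniWord n k) (i : Fin k) : (w.positions i).Nonempty := by
  obtain ⟨j, hj⟩ := w.2 i
  exact ⟨j, by simp [positions, hj]⟩

/-- `α_i(w)`: the position of the first (leftmost) letter `i` in `w`. -/
def alpha (w : FubiniWord n k) (i : Fin k) : Fin n :=
  (w.positions i).min' (w.positions_nonempty i)

/-- The multiset `{α_1(w), …, α_h(w)}` (used for `h ≤ k`). -/
def alphaInit (w : FubiniWord n k) (h : ℕ) : Multiset (Fin n) :=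
  (Finset.univ.filter fun i : Fin k => (i : ℕ) < h).val.map w.alpha

/-- The multiset `α_J(w) = {α_{w(j)} | j ∈ J}`. -/
def alphaSet (w : FubiniWord n k) (J : Finset (Fin n)) : Multiset (Fin n) :=
  J.val.map fun j => w.alpha (w.1 j)

/-- The set `in(w) = {α_1(w), …, α_k(w)}` of initial positions of `w`. -/
def initialPositions (w : FubiniWord n k) : Set (Fin n) :=
  Set.range w.alpha

/-- The entry in row `r` and column `j` of the pattern matrix of `w` is a star: `r = w_i` for an
initial position `i < α_{w(j)}` and either `j` is initial and `w_i < w_j`, or `j` is redundant. -/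
def IsStar (w : FubiniWord n k) (r : Fin k) (j : Fin n) : Prop :=
  ∃ i ∈ w.initialPositions, w.1 i = r ∧ i < w.alpha (w.1 j) ∧
    ((j ∈ w.initialPositions ∧ w.1 i < w.1 j) ∨ j ∉ w.initialPositions)

/-- The set `P_w` of complex `k × n` matrices fitting the pattern of `w`: the entries at
`(w_j, j)` are `1`, the entries at stars are arbitrary, and all the other entries are `0`. -/
def patternMatrices (w : FubiniWord n k) : Set (Matrix (Fin k) (Fin n) ℂ) :=
  {A | ∀ r j, (r = w.1 j → A r j = 1) ∧ (r ≠ w.1 j → ¬ w.IsStar r j → A r j = 0)}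

end FubiniWord

/-- The group `U` of lower unitriangular `k × k` complex matrices. -/
def lowerUnitriangular (k : ℕ) : Set (Matrix (Fin k) (Fin k) ℂ) :=
  {u | (∀ i, u i i = 1) ∧ ∀ i j, i < j → u i j = 0}

/-- The space `X_{n,k}` of spanning line configurations: `n`-tuples of points of the projective
space of `ℂ^k` (i.e. of lines through the origin) whose vector space sum is `ℂ^k`. -/
def SpanningLineConfig (n k : ℕ) : Type :=
  {l : Fin n → ℙ ℂ (Fin k → ℂ) // ⨆ j, (l j).submodule = ⊤}

namespace SpanningLineConfig

variable {n k : ℕ}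

/-- Homogeneous coordinates of `l`: the entry at `(i, j)` is the `i`-th coordinate of a
nonzero vector spanning the `j`-th line. -/
def coord (l : SpanningLineConfig n k) (p : Fin k × Fin n) : ℂ :=
  (l.1 p.2).rep p.1

/-- A polynomial in the entries of a `k × n` matrix is multihomogeneous if, for some `d`, it is
homogeneous of degree `d j` in the variables of the `j`-th column, for every `j`. -/
def IsMultihomogeneous (f : MvPolynomial (Fin k × Fin n) ℂ) : Prop :=
  ∃ d : Fin n → ℕ,
    MvPolynomial.IsWeightedHomogeneous (fun p : Fin k × Fin n => (Pi.single p.2 1 : Fin n → ℕ)) f d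

/-- The Zariski topology on `X_{n,k} ⊆ (ℙ^{k-1})^n`, generated by the complements of the zero loci
of multihomogeneous polynomials. (Whether such a polynomial vanishes at `l` does not depend on
the choice of the vectors spanning the lines.) -/
instance zariskiTopology : TopologicalSpace (SpanningLineConfig n k) :=
  TopologicalSpace.generateFrom
    {D | ∃ f : MvPolynomial (Fin k × Fin n) ℂ, IsMultihomogeneous f ∧
      D = {l : SpanningLineConfig n k | MvPolynomial.eval l.coord f ≠ 0}}

/-- `l` is the configuration of the lines spanned by the columns of `M`. -/
def IsRepresentedBy (l : SpanningLineConfig n k) (M : Matrix (Fin k) (Fin n) ℂ) : Prop :=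
  ∀ j, (l.1 j).submodule = Submodule.span ℂ {fun i => M i j}

end SpanningLineConfig

namespace FubiniWord

variable {n k : ℕ}

/-- The Pawlowski-Rhoades cell `C_w = U P_w` in `X_{n,k}`. -/
def cell (w : FubiniWord n k) : Set (SpanningLineConfig n k) :=
  {l | ∃ u ∈ lowerUnitriangular k, ∃ A ∈ w.patternMatrices, l.IsRepresentedBy (u * A)}

/-- The Pawlowski-Rhoades variety: the Zariski closure of `C_w` in `X_{n,k}`. -/
def variety (w : FubiniWord n k) : Set (SpanningLineConfig n k) :=
  closure w.cell

/-- The medium roast Fubini-Bruhat order: `v ≤ w` iff the closure of `C_v` contains `C_w`. -/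
def MediumRoastLE (v w : FubiniWord n k) : Prop :=
  w.cell ⊆ v.variety

/-- `C_v` touches `C_w`, written `v ⇀ w`: the closure of `C_v` meets `C_w`. -/
def Touches (v w : FubiniWord n k) : Prop :=
  (v.variety ∩ w.cell).Nonempty

end FubiniWord

/-- The Gale order on multisets of the same size: `A ⊴ B` iff, when both are
written in weakly increasing order, `a_i ≤ b_i` for all `i`. -/
def GaleLE {m : ℕ} (A B : Multiset (Fin m)) : Prop :=
  List.Forall₂ (· ≤ ·) (A.sort (· ≤ ·)) (B.sort (· ≤ ·))

end

/-! Everything is read off from the top minors: rows of index below `h`, columns `J` with `|J| = h`.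
They are unchanged by `U` (`topMinor_mul_of_lowerUnitriangular`). On `C_v` such a minor is not
identically zero exactly when `v.alphaInit h ⊴ v.alphaSet J`: a nonzero Leibniz term is a matching
that witnesses the Gale order, and Hall's theorem supplies a matching, hence a matrix with nonzero
minor, in return. Vanishing of a minor is Zariski closed, so the minors that are nonzero at a point
of the closure satisfy the Gale condition for `v`.

The converse, `mem_variety_of_topMinor`, is the heart of the proof. The Gale conditions give rank
bounds for the top rows of column blocks (`rankBounded_of_topMinor`), and a full-rank matrix obeying
these bounds is a Euclidean limit of matrices representing points of `C_v`
(`RankBounded.mem_closure_openOrbit`). Rows are processed in order of first occurrence: a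
well-placed pivot is eliminated by `U`, while a pivot that is too low is moved up by a rank-one
perturbation that respects the bounds. Euclidean limits lie in the Zariski closure.

The order is then tested against all minors not identically zero on `C_w`. Touching is tested
against the minors nonzero on all of `C_w`, which are exactly the nonzero minors of the 0/1 matrix
of `w`. The set of the first `h` initial positions of `w` gives the necessary condition. -/

noncomputable section

/-! ### The Gale order through counting and matchings. -/

section GaleOrder

theorem List.forall₂_le_of_countP {m : ℕ} : ∀ (l₁ l₂ : List (Fin m)),
    l₁.Pairwise (· ≤ ·) → l₂.Pairwise (· ≤ ·) → l₁.length = l₂.length →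
    (∀ t, l₂.countP (· ≤ t) ≤ l₁.countP (· ≤ t)) → List.Forall₂ (· ≤ ·) l₁ l₂
  | [], [], _, _, _, _ => .nil
  | [], _ :: _, _, _, h, _ => by simp at h
  | _ :: _, [], _, _, h, _ => by simp at h
  | a :: l₁, b :: l₂, h₁, h₂, h, hc => by
    rw [List.pairwise_cons] at h₁ h₂
    have hab : a ≤ b := by
      have hb := hc b
      have hpos : 0 < (a :: l₁).countP (· ≤ b) := by
        refine lt_of_lt_of_le ?_ hb
        rw [List.countP_pos_iff]
        exact ⟨b, by simp⟩
      obtain ⟨c, hc, hcb⟩ := List.countP_pos_iff.1 hpos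
      rcases List.mem_cons.1 hc with rfl | hc
      · simpa using hcb
      · exact (h₁.1 c hc).trans (by simpa using hcb)
    refine .cons hab (List.forall₂_le_of_countP l₁ l₂ h₁.2 h₂.2 (by simpa using h) fun t => ?_)
    by_cases hbt : b ≤ t
    · simpa [List.countP_cons, hbt, hab.trans hbt] using hc t
    · have : l₂.countP (· ≤ t) = 0 := by
        rw [List.countP_eq_zero]
        intro c hc hct
        exact hbt ((h₂.1 c hc).trans (by simpa using hct))
      omega

theorem List.Forall₂.countP_le {m : ℕ} {l₁ l₂ : List (Fin m)} (h : List.Forall₂ (· ≤ ·) l₁ l₂)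
    (t : Fin m) : l₂.countP (· ≤ t) ≤ l₁.countP (· ≤ t) := by
  induction h with
  | nil => simp
  | @cons a b _ _ hab _ ih =>
    rw [List.countP_cons, List.countP_cons]
    by_cases hbt : b ≤ t
    · simpa [hbt, hab.trans hbt] using ih
    · simp only [hbt, decide_false]
      simpa using ih.trans (Nat.le_add_right _ _)

theorem galeLE_iff_countP {m : ℕ} {A B : Multiset (Fin m)} :
    GaleLE A B ↔ A.card = B.card ∧ ∀ t, B.countP (· ≤ t) ≤ A.countP (· ≤ t) := by
  have key (C : Multiset (Fin m)) (t : Fin m) :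
      C.countP (· ≤ t) = (C.sort (· ≤ ·)).countP (· ≤ t) := by
    conv_lhs => rw [← Multiset.sort_eq C (· ≤ ·)]
    rw [Multiset.coe_countP]
  constructor
  · intro h
    refine ⟨?_, fun t => ?_⟩
    · simpa using h.length_eq
    · rw [key, key]
      exact h.countP_le t
  · rintro ⟨h, hc⟩
    refine List.forall₂_le_of_countP _ _ (Multiset.pairwise_sort _ _)
      (Multiset.pairwise_sort _ _) (by simpa using h) fun t => ?_
    rw [← key, ← key]
    exact hc t

theorem GaleLE.refl {m : ℕ} (A : Multiset (Fin m)) : GaleLE A A :=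
  galeLE_iff_countP.2 ⟨rfl, fun _ => le_rfl⟩

theorem GaleLE.trans {m : ℕ} {A B C : Multiset (Fin m)} (h₁ : GaleLE A B) (h₂ : GaleLE B C) :
    GaleLE A C := by
  rw [galeLE_iff_countP] at *
  exact ⟨h₁.1.trans h₂.1, fun t => (h₂.2 t).trans (h₁.2 t)⟩

theorem countP_map_val {m : ℕ} {ι : Type*} (s : Finset ι) (f : ι → Fin m) (t : Fin m) :
    (s.val.map f).countP (· ≤ t) = (s.filter fun i => f i ≤ t).card := by
  rw [Multiset.countP_map]
  rfl

/-- A matching that increases values forces the Gale order. -/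
theorem galeLE_map_of_matching {m : ℕ} {ι κ : Type*} {s : Finset ι} {t : Finset κ} {f : ι → Fin m}
    {g : κ → Fin m} (hcard : s.card = t.card) (e : t → ι) (hinj : Function.Injective e)
    (hle : ∀ j, e j ∈ s ∧ f (e j) ≤ g j) : GaleLE (s.val.map f) (t.val.map g) := by
  rw [galeLE_iff_countP]
  refine ⟨by simpa using hcard, fun c => ?_⟩
  rw [countP_map_val, countP_map_val]
  have hmem : ∀ j : (t.filter fun j => g j ≤ c), j.1 ∈ t := fun j => (Finset.mem_filter.1 j.2).1
  refine Finset.card_le_card_of_injective (f := fun j => ⟨e ⟨j.1, hmem j⟩, ?_⟩) ?_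
  · exact Finset.mem_filter.2
      ⟨(hle _).1, (hle _).2.trans (Finset.mem_filter.1 j.2).2⟩
  · intro j j' hjj'
    have := hinj (congrArg Subtype.val hjj')
    exact Subtype.ext (by simpa using this)

/-- Multisets in Gale order admit a matching that increases values. -/
theorem GaleLE.exists_matching {m : ℕ} {ι κ : Type*} [DecidableEq ι] {s : Finset ι} {t : Finset κ}
    {f : ι → Fin m} {g : κ → Fin m} (h : GaleLE (s.val.map f) (t.val.map g)) :
    ∃ e : t → ι, Function.Injective e ∧ ∀ j, e j ∈ s ∧ f (e j) ≤ g j := by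
  rw [galeLE_iff_countP] at h
  -- Hall's theorem: the neighbours of `X` include every `i ∈ s` with `f i` at most the maximum of
  -- `g` on `X`, so counting at that one threshold gives the marriage condition.
  have hall := (Finset.all_card_le_biUnion_card_iff_exists_injective
    (fun j : t => s.filter fun i => f i ≤ g j)).1 ?_
  · obtain ⟨e, he, hmem⟩ := hall
    exact ⟨e, he, fun j => by simpa using hmem j⟩
  · intro X
    rcases X.eq_empty_or_nonempty with rfl | hX
    · simp
    obtain ⟨j₀, hj₀, hmax⟩ := X.exists_max_image (fun j => g j) hX
    have hc := h.2 (g j₀)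
    rw [countP_map_val, countP_map_val] at hc
    calc X.card = (X.map (Function.Embedding.subtype _)).card := by simp
      _ ≤ (t.filter fun j => g j ≤ g j₀).card := by
        refine Finset.card_le_card fun j hj => ?_
        obtain ⟨j', hj', rfl⟩ := Finset.mem_map.1 hj
        simpa using hmax j' hj'
      _ ≤ (s.filter fun i => f i ≤ g j₀).card := hc
      _ ≤ _ := Finset.card_le_card
        (Finset.subset_biUnion_of_mem (fun j : t => s.filter fun i => f i ≤ g j) hj₀)

end GaleOrder

/-- A matrix that is triangular for an injective labelling of its indices. -/
theorem Matrix.det_eq_prod_of_le {ι Λ R : Type*} [Fintype ι] [DecidableEq ι] [LinearOrder Λ]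
    [CommRing R] {a : ι → Λ} (ha : Function.Injective a) {N : Matrix ι ι R}
    (hN : ∀ i j, N i j ≠ 0 → a i ≤ a j) : N.det = ∏ i, N i i := by
  rw [Matrix.det_apply]
  rw [Finset.sum_eq_single 1]
  · simp
  · intro σ _ hσ
    have : ∃ i, N (σ i) i = 0 := by
      by_contra! hne
      apply hσ
      have hle : ∀ i, a (σ i) ≤ a i := fun i => hN _ _ (hne i)
      by_contra hσ
      obtain ⟨i, hi⟩ : ∃ i, σ i ≠ i := by
        by_contra! h
        exact hσ (Equiv.ext h)
      -- Take a moved index with least label: its image is also moved, so cannot have a smaller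
      -- label, yet all labels weakly decrease under `σ`.
      obtain ⟨i₀, hi₀, hmin⟩ := (Finset.univ.filter fun i => σ i ≠ i).exists_min_image a
        ⟨i, by simpa using hi⟩
      simp only [Finset.mem_filter, Finset.mem_univ, true_and] at hi₀ hmin
      have h1 := hmin (σ i₀) (fun h => hi₀ (σ.injective h))
      exact hi₀ (ha (le_antisymm (hle i₀) h1))
    obtain ⟨i, hi⟩ := this
    have hprod : ∏ i, N (σ i) i = 0 := Finset.prod_eq_zero (Finset.mem_univ i) hi
    exact (congrArg _ hprod).trans (smul_zero _)
  · simp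

/-! ### Rank bounds, their perturbation and elimination. -/

section Degeneration

open Topology Filter Module

variable {k : ℕ} {ι Λ : Type*} [LinearOrder Λ]

/-- The projection onto the coordinates in `R`, with the other coordinates set to zero. -/
def coordProj (R : Finset (Fin k)) : (Fin k → ℂ) →ₗ[ℂ] (Fin k → ℂ) where
  toFun x r := if r ∈ R then x r else 0
  map_add' x y := by ext r; by_cases h : r ∈ R <;> simp [h]
  map_smul' c x := by ext r; by_cases h : r ∈ R <;> simp [h]

theorem coordProj_apply (R : Finset (Fin k)) (x : Fin k → ℂ) (r : Fin k) :
    coordProj R x r = if r ∈ R then x r else 0 := rfl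

theorem coordProj_eq_iff {R : Finset (Fin k)} {x y : Fin k → ℂ} :
    coordProj R x = coordProj R y ↔ ∀ r ∈ R, x r = y r := by
  constructor
  · intro h r hr
    simpa [coordProj_apply, hr] using congrFun h r
  · intro h
    ext r
    by_cases hr : r ∈ R
    · simp [coordProj_apply, hr, h r hr]
    · simp [coordProj_apply, hr]

theorem coordProj_eq_zero_iff {R : Finset (Fin k)} {x : Fin k → ℂ} :
    coordProj R x = 0 ↔ ∀ r ∈ R, x r = 0 := by
  rw [← map_zero (coordProj R), coordProj_eq_iff]
  simp

/-- The span of the columns of `M` with index in `T`. -/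
def colSpan (M : Matrix (Fin k) ι ℂ) (T : Set ι) : Submodule ℂ (Fin k → ℂ) :=
  Submodule.span ℂ ((fun j r => M r j) '' T)

theorem col_mem_colSpan (M : Matrix (Fin k) ι ℂ) {T : Set ι} {j : ι} (hj : j ∈ T) :
    (fun r => M r j) ∈ colSpan M T :=
  Submodule.subset_span ⟨j, hj, rfl⟩

theorem colSpan_le {M : Matrix (Fin k) ι ℂ} {T : Set ι} {W : Submodule ℂ (Fin k → ℂ)} :
    colSpan M T ≤ W ↔ ∀ j ∈ T, (fun r => M r j) ∈ W := by
  rw [colSpan, Submodule.span_le]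
  simp [Set.subset_def]

theorem colSpan_mono (M : Matrix (Fin k) ι ℂ) {T T' : Set ι} (h : T ⊆ T') :
    colSpan M T ≤ colSpan M T' :=
  Submodule.span_mono (Set.image_mono h)

theorem map_colSpan_le {M : Matrix (Fin k) ι ℂ} {T : Set ι} {W : Submodule ℂ (Fin k → ℂ)}
    (f : (Fin k → ℂ) →ₗ[ℂ] (Fin k → ℂ)) :
    (colSpan M T).map f ≤ W ↔ ∀ j ∈ T, f (fun r => M r j) ∈ W := by
  rw [Submodule.map_le_iff_le_comap, colSpan_le]
  rfl

theorem finrank_map_le_of_ker {E : Type*} [AddCommGroup E] [Module ℂ E] [FiniteDimensional ℂ E]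
    (V : Submodule ℂ E) (f g : E →ₗ[ℂ] E) (h : ∀ x ∈ V, g x = 0 → f x = 0) :
    finrank ℂ (V.map f) ≤ finrank ℂ (V.map g) := by
  have hf := LinearMap.finrank_range_add_finrank_ker (f.domRestrict V)
  have hg := LinearMap.finrank_range_add_finrank_ker (g.domRestrict V)
  rw [LinearMap.range_domRestrict] at hf hg
  have hle : LinearMap.ker (g.domRestrict V) ≤ LinearMap.ker (f.domRestrict V) := by
    intro x hx
    exact h x x.2 hx
  have := Submodule.finrank_mono hle
  omega

theorem finrank_map_lt_of_mem_ker {E : Type*} [AddCommGroup E] [Module ℂ E]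
    [FiniteDimensional ℂ E] (V : Submodule ℂ E) (f : E →ₗ[ℂ] E) {x : E} (hx : x ∈ V)
    (hx0 : x ≠ 0) (hfx : f x = 0) : finrank ℂ (V.map f) + 1 ≤ finrank ℂ V := by
  have hf := LinearMap.finrank_range_add_finrank_ker (f.domRestrict V)
  rw [LinearMap.range_domRestrict] at hf
  have : 0 < finrank ℂ (LinearMap.ker (f.domRestrict V)) := by
    have : Nontrivial (LinearMap.ker (f.domRestrict V)) :=
      ⟨⟨⟨⟨x, hx⟩, hfx⟩, 0, fun h => hx0 (congrArg Subtype.val (congrArg Subtype.val h))⟩⟩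
    exact finrank_pos
  omega

/-- The rows of index less than `h` outside `S`. -/
def topRows (S : Finset (Fin k)) (h : ℕ) : Finset (Fin k) :=
  Finset.univ.filter fun r => (r : ℕ) < h ∧ r ∉ S

theorem mem_topRows {S : Finset (Fin k)} {h : ℕ} {r : Fin k} :
    r ∈ topRows S h ↔ (r : ℕ) < h ∧ r ∉ S := by
  simp [topRows]

/-- The elementary matrix `1 + z ⊗ e_p`, which adds multiples of row `p` to the other rows. -/
def rowOp (p : Fin k) (z : Fin k → ℂ) : Matrix (Fin k) (Fin k) ℂ :=
  1 + Matrix.vecMulVec z (Pi.single p 1)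

theorem rowOp_mul_apply {κ : Type*} (p : Fin k) (z : Fin k → ℂ) (N : Matrix (Fin k) κ ℂ)
    (r : Fin k) (j : κ) : (rowOp p z * N) r j = N r j + z r * N p j := by
  rw [rowOp, Matrix.add_mul, Matrix.one_mul, Matrix.add_apply, Matrix.vecMulVec_mul]
  simp [Matrix.vecMulVec_apply]

theorem rowOp_mul_rowOp_neg (p : Fin k) {z : Fin k → ℂ} (hz : z p = 0) :
    rowOp p z * rowOp p (-z) = 1 := by
  ext r q
  have h (r : Fin k) : rowOp p (-z) r q = (1 : Matrix (Fin k) (Fin k) ℂ) r q +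
      -z r * (1 : Matrix (Fin k) (Fin k) ℂ) p q := by
    simpa using rowOp_mul_apply p (-z) 1 r q
  rw [rowOp_mul_apply, h, h, hz]
  ring

theorem rowOp_mem (p : Fin k) {z : Fin k → ℂ} (hz : ∀ r ≤ p, z r = 0) :
    rowOp p z ∈ lowerUnitriangular k := by
  have h (r q : Fin k) : rowOp p z r q = (1 : Matrix (Fin k) (Fin k) ℂ) r q +
      z r * (1 : Matrix (Fin k) (Fin k) ℂ) p q := by
    simpa using rowOp_mul_apply p z 1 r q
  refine ⟨fun i => ?_, fun i j hij => ?_⟩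
  · rcases eq_or_ne p i with rfl | hi
    · simp [h, hz]
    · simp [h, hi]
  · rcases eq_or_ne p j with rfl | hj
    · simp [h, hij.ne, hz i hij.le]
    · simp [h, hij.ne, hj]

/-- Rank conditions, away from the rows in `S`, that describe the closure of the
matrices `u * Q` with `u` lower unitriangular and `Q r j = 0` unless `a r ≤ a (v j)`. -/
structure RankBounded (a : Fin k → Λ) (v : ι → Fin k) (S : Finset (Fin k))
    (M : Matrix (Fin k) ι ℂ) [Fintype ι] : Prop where
  mem_of_le : ∀ r ∈ S, ∀ r', a r' ≤ a r → r' ∈ S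
  support : ∀ j, v j ∈ S → ∀ r, M r j ≠ 0 → a r ≤ a (v j)
  rank_le : ∀ h ≤ k, ∀ m, finrank ℂ ((colSpan M {j | a (v j) ≤ a m}).map
    (coordProj (topRows S h))) ≤ ((topRows S h).filter fun r => a r ≤ a m).card
  rightInv : ∃ B : Matrix ι (Fin k) ℂ, M * B = 1

namespace RankBounded

variable [Fintype ι] {a : Fin k → Λ} {v : ι → Fin k} {S : Finset (Fin k)}
  {M : Matrix (Fin k) ι ℂ} {p : Fin k} {j₀ : ι}

/-- As `p` has the least label outside `S`, no row above `p` outside `S` is counted in the bound for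
the block of `p`; that bound is therefore zero. -/
theorem eq_zero_of_lt (hM : RankBounded a v S M) (ha : Function.Injective a)
    (hmin : ∀ r ∉ S, a p ≤ a r) (hj₀ : v j₀ = p) {r : Fin k} (hrS : r ∉ S) (hr : r < p) :
    M r j₀ = 0 := by
  have h := hM.rank_le p p.2.le p
  have hcard : ((topRows S p).filter fun r => a r ≤ a p).card = 0 := by
    rw [Finset.card_eq_zero, Finset.filter_eq_empty_iff]
    intro q hq hqp
    rw [mem_topRows] at hq
    have := ha (le_antisymm hqp (hmin q hq.2))
    subst this
    exact lt_irrefl _ hq.1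
  rw [hcard, Nat.le_zero, Submodule.finrank_eq_zero] at h
  have hmem := Submodule.mem_map_of_mem (f := coordProj (topRows S p))
    (col_mem_colSpan M (T := {j | a (v j) ≤ a p}) (j := j₀) (by simp [hj₀]))
  rw [h, Submodule.mem_bot, coordProj_eq_zero_iff] at hmem
  exact hmem r (mem_topRows.2 ⟨hr, hrS⟩)

theorem colSpan_univ (hM : RankBounded a v S M) : colSpan M Set.univ = ⊤ := by
  obtain ⟨B, hB⟩ := hM.rightInv
  rw [eq_top_iff]
  intro x _
  have hx : x = ∑ j, (B.mulVec x j) • (fun r => M r j) := by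
    have : M.mulVec (B.mulVec x) = x := by rw [Matrix.mulVec_mulVec, hB, Matrix.one_mulVec]
    conv_lhs => rw [← this]
    ext r
    simp [Matrix.mulVec, dotProduct, mul_comm]
  rw [hx]
  exact Submodule.sum_mem _ fun j _ => Submodule.smul_mem _ _ (col_mem_colSpan M (Set.mem_univ j))

/-- The block containing all columns spans everything, in particular the basis vector at `p`.
Choosing `a m` least among the blocks that contain such a vector gives the final clause, which keeps
smaller blocks under control in `perturb`. -/
theorem exists_pivot (hM : RankBounded a v S M) (hpS : p ∉ S) {d : ℕ} (hd : (p : ℕ) < d) :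
    ∃ m, ∃ y ∈ colSpan M {j | a (v j) ≤ a m}, (∀ r ∉ S, r < p → y r = 0) ∧
      (∃ r ∉ S, (r : ℕ) < d ∧ y r ≠ 0) ∧
      ∀ m', a m' < a m → ∀ z ∈ colSpan M {j | a (v j) ≤ a m'}, (∀ r ∉ S, r < p → z r = 0) →
        ∀ r ∉ S, (r : ℕ) < d → z r = 0 := by
  classical
  let P : Fin k → Prop := fun m => ∃ y ∈ colSpan M {j | a (v j) ≤ a m},
    (∀ r ∉ S, r < p → y r = 0) ∧ ∃ r ∉ S, (r : ℕ) < d ∧ y r ≠ 0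
  have hne : (Finset.univ.filter P).Nonempty := by
    obtain ⟨m, -, hm⟩ := Finset.exists_max_image Finset.univ a ⟨p, Finset.mem_univ p⟩
    refine ⟨m, by
      simp only [Finset.mem_filter, Finset.mem_univ, true_and]
      refine ⟨Pi.single p 1, ?_, fun r _ hr => Pi.single_eq_of_ne hr.ne _, p, hpS, hd, by simp⟩
      have : {j | a (v j) ≤ a m} = Set.univ := by
        ext j
        simpa using hm (v j) (Finset.mem_univ _)
      rw [this, hM.colSpan_univ]
      trivial⟩
  obtain ⟨m, hm, hmin⟩ := (Finset.univ.filter P).exists_min_image a hne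
  simp only [Finset.mem_filter, Finset.mem_univ, true_and] at hm hmin
  obtain ⟨y, hy, hy0, hyd⟩ := hm
  refine ⟨m, y, hy, hy0, hyd, fun m' hm' z hz hz0 r hr hrd => ?_⟩
  by_contra hzr
  exact (hmin m' ⟨z, hz, hz0, r, hr, hrd, hzr⟩).not_gt hm'

/-- A rank-one change along the pivot `y` can only threaten the bounds for blocks below `m` and
heights `h > p`. Up to height `d` there is one unit of slack, because row `p` has entered the count;
beyond `d` the change is induced by a linear map on the truncated columns. -/
theorem perturb (hM : RankBounded a v S M) {M' : Matrix (Fin k) ι ℂ} (hpS : p ∉ S)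
    (hmin : ∀ r ∉ S, a p ≤ a r) {d : ℕ} {m : Fin k} {y : Fin k → ℂ}
    (hy : y ∈ colSpan M {j | a (v j) ≤ a m})
    (hy0 : ∀ r ∉ S, r < p → y r = 0)
    (hyd : ∀ m', a m' < a m → ∀ z ∈ colSpan M {j | a (v j) ≤ a m'},
      (∀ r ∉ S, r < p → z r = 0) → ∀ r ∉ S, (r : ℕ) < d → z r = 0)
    {c : ι → ℂ} (hcS : ∀ j, v j ∈ S → c j = 0)
    (hc : ∀ h ≤ k, d < h → ∃ ξ : (Fin k → ℂ) →ₗ[ℂ] ℂ,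
      ∀ j, c j = ξ (coordProj (topRows S h) fun r => M r j))
    (hM' : ∀ r j, M' r j = M r j + c j * y r) (hB : ∃ B : Matrix ι (Fin k) ℂ, M' * B = 1) :
    RankBounded a v S M' := by
  have hcol : ∀ j, (fun r => M' r j) = (fun r => M r j) + c j • y := by
    intro j
    ext r
    simp [hM']
  refine ⟨hM.mem_of_le, fun j hj r hr => ?_, fun h hk m' => ?_, hB⟩
  · rw [hM', hcS j hj, zero_mul, add_zero] at hr
    exact hM.support j hj r hr
  · set f := coordProj (topRows S h) with hf
    by_cases hm' : a m ≤ a m'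
    · refine le_trans (Submodule.finrank_mono (Submodule.map_mono ?_)) (hM.rank_le h hk m')
      rw [colSpan_le]
      intro j hj
      rw [hcol]
      refine add_mem (col_mem_colSpan M hj) (Submodule.smul_mem _ _ (colSpan_mono M ?_ hy))
      exact fun i hi => le_trans hi hm'
    rw [not_le] at hm'
    rcases le_or_gt h p with hhp | hhp
    · refine le_trans (Submodule.finrank_mono ?_) (hM.rank_le h hk m')
      rw [map_colSpan_le]
      intro j hj
      have : f y = 0 := by
        rw [hf, coordProj_eq_zero_iff]
        intro r hr
        rw [mem_topRows] at hr
        exact hy0 r hr.2 (Fin.lt_def.2 (by omega))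
      rw [hcol, map_add, map_smul, this, smul_zero, add_zero]
      exact Submodule.mem_map_of_mem (col_mem_colSpan M hj)
    rcases le_or_gt h d with hhd | hhd
    · by_cases hpm : a p ≤ a m'
      -- Minimality of `m`: on this block, vanishing in the rows above `p` outside `S` forces
      -- vanishing up to `d`, so the old rank at height `h` is at most the rank at height `p`.
      · have h1 : finrank ℂ ((colSpan M {j | a (v j) ≤ a m'}).map f) ≤
            finrank ℂ ((colSpan M {j | a (v j) ≤ a m'}).map (coordProj (topRows S p))) := by
          refine finrank_map_le_of_ker _ _ _ fun x hx hx0 => ?_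
          rw [coordProj_eq_zero_iff] at hx0
          rw [hf, coordProj_eq_zero_iff]
          intro r hr
          rw [mem_topRows] at hr
          exact hyd m' hm' x hx (fun q hq hqp => hx0 q (mem_topRows.2 ⟨hqp, hq⟩)) r hr.2 (by omega)
        have h2 := hM.rank_le p p.2.le m'
        have h3 : ((topRows S p).filter fun r => a r ≤ a m').card + 1 ≤
            ((topRows S h).filter fun r => a r ≤ a m').card := by
          rw [Nat.add_one_le_iff]
          refine Finset.card_lt_card (Finset.ssubset_iff.2 ⟨p, by simp [mem_topRows], ?_⟩)
          intro r hr
          simp only [Finset.mem_insert, Finset.mem_filter, mem_topRows] at hr ⊢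
          rcases hr with rfl | hr
          · exact ⟨⟨hhp, hpS⟩, hpm⟩
          · exact ⟨⟨by omega, hr.1.2⟩, hr.2⟩
        have h4 : finrank ℂ ((colSpan M' {j | a (v j) ≤ a m'}).map f) ≤
            finrank ℂ ((colSpan M {j | a (v j) ≤ a m'}).map f) + 1 := by
          calc _ ≤ finrank ℂ ((colSpan M {j | a (v j) ≤ a m'}).map f ⊔
                Submodule.span ℂ {f y} : Submodule ℂ (Fin k → ℂ)) := by
                refine Submodule.finrank_mono ?_
                rw [map_colSpan_le]
                intro j hj
                rw [hcol, map_add, map_smul]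
                exact Submodule.add_mem_sup (Submodule.mem_map_of_mem (col_mem_colSpan M hj))
                  (Submodule.smul_mem _ _ (Submodule.mem_span_singleton_self _))
            _ ≤ _ := (Submodule.finrank_add_le_finrank_add_finrank _ _).trans
                (Nat.add_le_add_left
                  ((finrank_span_le_card ({f y} : Set (Fin k → ℂ))).trans (by simp)) _)
        omega
      · refine le_trans (Submodule.finrank_mono ?_) (hM.rank_le h hk m')
        rw [map_colSpan_le]
        intro j hj
        have hjS : v j ∈ S := by
          by_contra hjS
          exact hpm ((hmin _ hjS).trans hj)
        rw [hcol, hcS j hjS, zero_smul, add_zero]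
        exact Submodule.mem_map_of_mem (col_mem_colSpan M hj)
    · obtain ⟨ξ, hξ⟩ := hc h hk hhd
      refine le_trans ?_ (hM.rank_le h hk m')
      have hle : (colSpan M' {j | a (v j) ≤ a m'}).map f ≤
          ((colSpan M {j | a (v j) ≤ a m'}).map f).map
            (LinearMap.id + ξ.smulRight (f y)) := by
        rw [map_colSpan_le]
        intro j hj
        refine ⟨f fun r => M r j, Submodule.mem_map_of_mem (col_mem_colSpan M hj), ?_⟩
        rw [hcol, map_add, map_smul, hξ j]
        rfl
      exact (Submodule.finrank_mono hle).trans (Submodule.finrank_map_le _ _)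


/-- Moves the first nonzero entry of column `j₀` outside `S` to a row above `d`, by arbitrarily
small changes. -/
theorem exists_degeneration [DecidableEq ι] (hM : RankBounded a v S M) (hpS : p ∉ S)
    (hmin : ∀ r ∉ S, a p ≤ a r) (hj₀ : v j₀ = p) {d : ℕ} (hd : (p : ℕ) < d) (hdk : d ≤ k)
    (h0 : ∀ r ∉ S, (r : ℕ) < d → M r j₀ = 0)
    (h1 : ∀ h : d < k, (⟨d, h⟩ : Fin k) ∉ S ∧ M ⟨d, h⟩ j₀ ≠ 0) :
    ∃ N : Matrix (Fin k) ι ℂ, ∀ᶠ s in 𝓝[≠] (0 : ℂ), RankBounded a v S (M + s • N) ∧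
      ∃ r ∉ S, (r : ℕ) < d ∧ (M + s • N) r j₀ ≠ 0 := by
  obtain ⟨m, y, hy, hy0, ⟨q, hqS, hqd, hyq⟩, hyd⟩ := hM.exists_pivot hpS hd
  -- Row `d` scaled to be `1` at `j₀`, so that it is a linear functional of the columns visible at
  -- heights above `d`. When `d = k` there are no such heights, and the indicator of `j₀` suffices.
  let c : ι → ℂ := fun j =>
    if h : d < k then M ⟨d, h⟩ j / M ⟨d, h⟩ j₀ else if j = j₀ then 1 else 0
  have hc0 : c j₀ = 1 := by
    by_cases h : d < k
    · simp [c, h, div_self (h1 h).2]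
    · simp [c, h]
  have hcS : ∀ j, v j ∈ S → c j = 0 := by
    intro j hj
    by_cases h : d < k
    · have : M ⟨d, h⟩ j = 0 := by
        by_contra hne
        exact (h1 h).1 (hM.mem_of_le _ hj _ (hM.support j hj _ hne))
      simp [c, h, this]
    · have : j ≠ j₀ := by
        rintro rfl
        exact hpS (hj₀ ▸ hj)
      simp [c, h, this]
  obtain ⟨B, hB⟩ := hM.rightInv
  refine ⟨Matrix.of fun r j => c j * y r, ?_⟩
  -- Full rank persists for small `s`: the product with the old right inverse has determinant `1` at
  -- `s = 0`.
  have hdet : ∀ᶠ s in 𝓝[≠] (0 : ℂ),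
      ((M + s • Matrix.of fun r j => c j * y r) * B).det ≠ 0 := by
    refine eventually_nhdsWithin_of_eventually_nhds (ContinuousAt.eventually_ne ?_ ?_)
    · refine Continuous.continuousAt (Continuous.matrix_det ?_)
      exact Continuous.matrix_mul (by fun_prop) continuous_const
    · simp [hB]
  filter_upwards [hdet, self_mem_nhdsWithin] with s hs hs0
  have hs0 : s ≠ 0 := hs0
  refine ⟨hM.perturb hpS hmin (y := s • y) (c := c) (Submodule.smul_mem _ _ hy) ?_ hyd hcS ?_ ?_ ?_,
    q, hqS, hqd, ?_⟩
  · intro r hr hrp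
    simp [hy0 r hr hrp]
  · intro h hk hdh
    have hdk' : d < k := by omega
    refine ⟨(M ⟨d, hdk'⟩ j₀)⁻¹ • LinearMap.proj (⟨d, hdk'⟩ : Fin k), fun j => ?_⟩
    have : (⟨d, hdk'⟩ : Fin k) ∈ topRows S h := mem_topRows.2 ⟨hdh, (h1 hdk').1⟩
    simp [c, hdk', coordProj_apply, this, div_eq_inv_mul]
  · intro r j
    simp
    ring
  · refine ⟨B * ((M + s • Matrix.of fun r j => c j * y r) * B)⁻¹, ?_⟩
    rw [← Matrix.mul_assoc, Matrix.mul_nonsing_inv _ (isUnit_iff_ne_zero.2 hs)]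
  · simp [h0 q hqS hqd, hc0, hs0, hyq]

/-- Column `j₀` already vanishes above its pivot outside `S`, so only entries below `p` need
clearing, which a lower unitriangular row operation does. -/
theorem exists_elimination (hM : RankBounded a v S M) (ha : Function.Injective a) (hpS : p ∉ S)
    (hmin : ∀ r ∉ S, a p ≤ a r) (hj₀ : v j₀ = p) (hp : M p j₀ ≠ 0) :
    ∃ u ∈ lowerUnitriangular k, ∃ M', M = u * M' ∧ RankBounded a v (insert p S) M' := by
  classical
  have hlt : ∀ r ∉ S, r < p → M r j₀ = 0 := fun r hrS hr => hM.eq_zero_of_lt ha hmin hj₀ hrS hr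
  let z : Fin k → ℂ := fun r => if p < r ∧ r ∉ S then M r j₀ / M p j₀ else 0
  have hzlt : ∀ r ≤ p, z r = 0 := fun r hr => by simp [z, hr.not_gt]
  have hpnot : ∀ j, v j ∈ S → M p j = 0 := by
    intro j hj
    by_contra hne
    exact hpS (hM.mem_of_le _ hj _ (hM.support j hj _ hne))
  have hx : ∀ r ∉ S, r ≠ p → M r j₀ - z r * M p j₀ = 0 := by
    intro r hr hrp
    rcases lt_or_gt_of_ne hrp with h | h
    · simp [hlt r hr h, hzlt r h.le]
    · simp [z, h, hr, hp]
  have hinv := rowOp_mul_rowOp_neg p (hzlt p le_rfl)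
  have hu' (r : Fin k) (j : ι) : (rowOp p (-z) * M) r j = M r j - z r * M p j := by
    rw [rowOp_mul_apply, Pi.neg_apply]
    ring
  refine ⟨rowOp p z, rowOp_mem p hzlt, rowOp p (-z) * M, ?_, ?_, ?_, ?_, ?_⟩
  · rw [← Matrix.mul_assoc, hinv, Matrix.one_mul]
  · intro r hr r' hr'
    rw [Finset.mem_insert] at hr ⊢
    rcases hr with rfl | hr
    · by_cases h : r' ∈ S
      · exact Or.inr h
      · exact Or.inl (ha (le_antisymm hr' (hmin r' h)))
    · exact Or.inr (hM.mem_of_le r hr r' hr')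
  · intro j hj r hr
    rw [hu'] at hr
    rcases Finset.mem_insert.1 hj with hj | hj
    · by_contra har
      rw [hj, not_le] at har
      have hrS : r ∉ S := fun h => hpS (hM.mem_of_le r h p har.le)
      have hrp : r ≠ p := by
        rintro rfl
        exact lt_irrefl _ har
      set f := coordProj (topRows S k)
      have hmemS : ∀ q, q ∉ S → q ∈ topRows S k := fun q hq => mem_topRows.2 ⟨q.2, hq⟩
      set W := (colSpan M {j | a (v j) ≤ a p}).map f with hW
      have hmem : ∀ i, v i = p → f (fun r => M r i) ∈ W := fun i hi =>
        Submodule.mem_map_of_mem (col_mem_colSpan M (by simp [hi]))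
      have hx0 : f (fun r => M r j₀) ≠ 0 := by
        intro h
        exact hp (coordProj_eq_zero_iff.1 h p (hmemS p hpS))
      -- Only `p` is counted here, so modulo the rows in `S` every column with letter `p` is a
      -- multiple of column `j₀` and is cleared along with it.
      have hcard : ((topRows S k).filter fun r => a r ≤ a p).card ≤ 1 := by
        rw [Finset.card_le_one]
        intro q hq q' hq'
        rw [Finset.mem_filter, mem_topRows] at hq hq'
        exact ha ((hq.2.trans (hmin _ hq'.1.2)).antisymm (hq'.2.trans (hmin _ hq.1.2)))
      have hspan : Submodule.span ℂ {f fun r => M r j₀} = W := by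
        refine Submodule.eq_of_le_of_finrank_le ?_ ?_
        · rw [Submodule.span_singleton_le_iff_mem]
          exact hmem j₀ hj₀
        · rw [finrank_span_singleton hx0]
          exact (hM.rank_le k le_rfl p).trans hcard
      have hj' := hmem j hj
      rw [← hspan, Submodule.mem_span_singleton] at hj'
      obtain ⟨l, hl⟩ := hj'
      rw [← map_smul, coordProj_eq_iff] at hl
      have e1 := hl r (hmemS r hrS)
      have e2 := hl p (hmemS p hpS)
      simp only [Pi.smul_apply, smul_eq_mul] at e1 e2
      apply hr
      rw [← e1, ← e2]
      linear_combination l * hx r hrS hrp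
    · rw [hpnot j hj, mul_zero, sub_zero] at hr
      exact hM.support j hj r hr
  · intro h hk m
    -- If `p` is counted, the bound drops by one, and so does the rank, since `ψ` kills the nonzero
    -- truncated column `j₀`. Otherwise the bound is unchanged: either the operation leaves the rows
    -- below height `h` alone, or the block consists of columns with letter in `S`, which vanish in
    -- row `p`.
    by_cases hcase : p ∈ topRows S h ∧ a p ≤ a m
    · obtain ⟨hph, hpm⟩ := hcase
      have hcard : ((topRows (insert p S) h).filter fun r => a r ≤ a m).card + 1 =
          ((topRows S h).filter fun r => a r ≤ a m).card := by
        rw [← Finset.card_insert_of_notMem (a := p) (by simp [mem_topRows])]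
        congr 1
        ext r
        by_cases hrp : r = p
        · subst hrp
          simp [hph, hpm]
        · simp [mem_topRows, hrp]
      have hrank := hM.rank_le h hk m
      set f := coordProj (topRows S h)
      have hj₀m : j₀ ∈ {j | a (v j) ≤ a m} := by simpa [hj₀] using hpm
      let ψ : (Fin k → ℂ) →ₗ[ℂ] (Fin k → ℂ) :=
        coordProj (topRows (insert p S) h) ∘ₗ
          (LinearMap.id - (LinearMap.proj p : (Fin k → ℂ) →ₗ[ℂ] ℂ).smulRight z)
      have hψ : ∀ x : Fin k → ℂ, ψ (f x) = coordProj (topRows (insert p S) h)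
          (fun r => x r - z r * x p) := by
        intro x
        simp only [ψ, LinearMap.comp_apply]
        rw [coordProj_eq_iff]
        intro r hr
        have hr' : r ∈ topRows S h := by
          rw [mem_topRows, Finset.mem_insert, not_or] at hr
          exact mem_topRows.2 ⟨hr.1, hr.2.2⟩
        simp [f, coordProj_apply, hr', hph, mul_comm]
      have hlt := finrank_map_lt_of_mem_ker ((colSpan M {j | a (v j) ≤ a m}).map f) ψ
        (Submodule.mem_map_of_mem (f := f) (col_mem_colSpan M hj₀m))
        (fun h => hp (coordProj_eq_zero_iff.1 h p hph)) (by
          rw [hψ, coordProj_eq_zero_iff]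
          intro r hr
          rw [mem_topRows, Finset.mem_insert, not_or] at hr
          exact hx r hr.2.2 hr.2.1)
      have hle : (colSpan (rowOp p (-z) * M) {j | a (v j) ≤ a m}).map
          (coordProj (topRows (insert p S) h)) ≤
          ((colSpan M {j | a (v j) ≤ a m}).map f).map ψ := by
        rw [map_colSpan_le]
        intro j hj
        refine ⟨_, Submodule.mem_map_of_mem (f := f) (col_mem_colSpan M hj), ?_⟩
        rw [hψ]
        congr 1
        ext r
        rw [hu']
      have := Submodule.finrank_mono hle
      omega
    · have hcard : ((topRows (insert p S) h).filter fun r => a r ≤ a m) =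
          ((topRows S h).filter fun r => a r ≤ a m) := by
        ext r
        by_cases hrp : r = p
        · subst hrp
          simp only [Finset.mem_filter]
          constructor
          · rintro ⟨h1, -⟩
            simp [mem_topRows] at h1
          · exact fun h => absurd h hcase
        · simp [mem_topRows, hrp]
      rw [hcard]
      refine le_trans ?_ (hM.rank_le h hk m)
      have hker := finrank_map_le_of_ker (colSpan M {j | a (v j) ≤ a m})
        (coordProj (topRows (insert p S) h)) (coordProj (topRows S h)) (by
          intro x _ hx
          rw [coordProj_eq_zero_iff] at hx ⊢
          intro r hr
          rw [mem_topRows, Finset.mem_insert, not_or] at hr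
          exact hx r (mem_topRows.2 ⟨hr.1, hr.2.2⟩))
      refine le_trans (Submodule.finrank_mono ?_) hker
      rw [map_colSpan_le]
      intro j hj
      refine ⟨_, col_mem_colSpan M hj, ?_⟩
      rw [coordProj_eq_iff]
      intro r hr
      rw [mem_topRows, Finset.mem_insert, not_or] at hr
      rw [hu']
      by_cases hpm : a p ≤ a m
      · have : ¬ (p : ℕ) < h := fun hph => hcase ⟨mem_topRows.2 ⟨hph, hpS⟩, hpm⟩
        rw [hzlt r (Fin.le_def.2 (by omega)), zero_mul, sub_zero]
      · have hjS : v j ∈ S := by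
          by_contra hjS
          exact hpm ((hmin _ hjS).trans hj)
        rw [hpnot j hjS, mul_zero, sub_zero]
  · obtain ⟨B, hB⟩ := hM.rightInv
    refine ⟨B * rowOp p z, ?_⟩
    rw [Matrix.mul_assoc, ← Matrix.mul_assoc M, hB, Matrix.one_mul, mul_eq_one_comm.1 hinv]

end RankBounded

/-! ### The Euclidean closure of the open orbit. -/

/-- The products `u * Q` with `u` lower unitriangular, `Q r j = 0` unless `a r ≤ a (v j)`, and
`Q (v j) j ≠ 0`. -/
def openOrbit (a : Fin k → Λ) (v : ι → Fin k) : Set (Matrix (Fin k) ι ℂ) :=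
  {M | ∃ u ∈ lowerUnitriangular k, ∃ Q : Matrix (Fin k) ι ℂ,
    (∀ r j, Q r j ≠ 0 → a r ≤ a (v j)) ∧ (∀ j, Q (v j) j ≠ 0) ∧ M = u * Q}

theorem one_mem_lowerUnitriangular :
    (1 : Matrix (Fin k) (Fin k) ℂ) ∈ lowerUnitriangular k :=
  ⟨fun i => by simp, fun i j hij => by simp [hij.ne]⟩

theorem mul_mem_lowerUnitriangular {u u' : Matrix (Fin k) (Fin k) ℂ}
    (hu : u ∈ lowerUnitriangular k) (hu' : u' ∈ lowerUnitriangular k) :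
    u * u' ∈ lowerUnitriangular k := by
  constructor
  · intro i
    rw [Matrix.mul_apply, Finset.sum_eq_single i]
    · rw [hu.1, hu'.1, one_mul]
    · intro j _ hj
      rcases lt_or_gt_of_ne hj with h | h
      · rw [hu'.2 j i h, mul_zero]
      · rw [hu.2 i j h, zero_mul]
    · simp
  · intro i j hij
    rw [Matrix.mul_apply]
    refine Finset.sum_eq_zero fun l _ => ?_
    rcases lt_or_ge i l with h | h
    · rw [hu.2 i l h, zero_mul]
    · rw [hu'.2 l j (h.trans_lt hij), mul_zero]

theorem mul_mem_closure_openOrbit {a : Fin k → Λ} {v : ι → Fin k}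
    {u : Matrix (Fin k) (Fin k) ℂ} (hu : u ∈ lowerUnitriangular k) {M : Matrix (Fin k) ι ℂ}
    (hM : M ∈ closure (openOrbit a v)) : u * M ∈ closure (openOrbit a v) := by
  refine map_mem_closure (f := fun N : Matrix (Fin k) ι ℂ => u * N)
    (continuous_const.matrix_mul continuous_id) hM ?_
  rintro _ ⟨u', hu', Q, hQ, hQ', rfl⟩
  exact ⟨u * u', mul_mem_lowerUnitriangular hu hu', Q, hQ, hQ', (Matrix.mul_assoc _ _ _).symm⟩

theorem mem_closure_of_eventually_add_smul {s : Set (Matrix (Fin k) ι ℂ)}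
    {M N : Matrix (Fin k) ι ℂ} (h : ∀ᶠ c in 𝓝[≠] (0 : ℂ), M + c • N ∈ s) : M ∈ closure s := by
  have hcont : Continuous fun c : ℂ => M + c • N := by fun_prop
  have ht : Tendsto (fun c : ℂ => M + c • N) (𝓝[≠] 0) (𝓝 M) := by
    have := (hcont.tendsto 0).mono_left (nhdsWithin_le_nhds (s := {0}ᶜ))
    simpa using this
  exact mem_closure_of_tendsto ht h

theorem mem_closure_openOrbit_of_support {a : Fin k → Λ} {v : ι → Fin k} [Finite ι]
    {M : Matrix (Fin k) ι ℂ} (hM : ∀ r j, M r j ≠ 0 → a r ≤ a (v j)) :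
    M ∈ closure (openOrbit a v) := by
  refine mem_closure_of_eventually_add_smul
    (N := Matrix.of fun r j => if r = v j then 1 else 0) ?_
  have h : ∀ j, ∀ᶠ c in 𝓝[≠] (0 : ℂ), M (v j) j + c ≠ 0 := by
    intro j
    by_cases hj : M (v j) j = 0
    · filter_upwards [self_mem_nhdsWithin] with c hc
      simpa [hj] using hc
    · refine eventually_nhdsWithin_of_eventually_nhds (ContinuousAt.eventually_ne ?_ ?_)
      · fun_prop
      · simpa using hj
  filter_upwards [eventually_all.2 h] with c hc
  refine ⟨1, one_mem_lowerUnitriangular, _, ?_, ?_,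
    (Matrix.one_mul _).symm⟩
  · intro r j hrj
    by_cases hr : r = v j
    · rw [hr]
    · exact hM r j (by simpa [hr] using hrj)
  · intro j
    simpa using hc j

/-- Outer induction on the number of rows outside `S`; inner induction on the first row `d` outside
`S` where column `j₀` is nonzero, with `d = k` if there is none. -/
theorem RankBounded.mem_closure_openOrbit [Fintype ι] {a : Fin k → Λ} {v : ι → Fin k}
    (ha : Function.Injective a) (hv : Function.Surjective v) {S : Finset (Fin k)}
    {M : Matrix (Fin k) ι ℂ} (hM : RankBounded a v S M) : M ∈ closure (openOrbit a v) := by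
  classical
  induction hn : Sᶜ.card using Nat.strong_induction_on generalizing S M with
  | _ n ih =>
  rcases Sᶜ.eq_empty_or_nonempty with hS | hS
  · have hS : S = Finset.univ := by simpa using hS
    exact mem_closure_openOrbit_of_support fun r j => hM.support j (by simp [hS]) r
  obtain ⟨p, hp, hmin⟩ := Sᶜ.exists_min_image a hS
  simp only [Finset.mem_compl] at hp hmin
  obtain ⟨j₀, hj₀⟩ := hv p
  have main : ∀ d : ℕ, ∀ N : Matrix (Fin k) ι ℂ, RankBounded a v S N → d ≤ k →
      (∀ r ∉ S, (r : ℕ) < d → N r j₀ = 0) →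
      (∀ h : d < k, (⟨d, h⟩ : Fin k) ∉ S ∧ N ⟨d, h⟩ j₀ ≠ 0) → N ∈ closure (openOrbit a v) := by
    intro d
    induction d using Nat.strong_induction_on with
    | _ d ihd =>
    intro N hN hdk h0 h1
    rcases lt_trichotomy d p with hdp | hdp | hdp
    · exact absurd (hN.eq_zero_of_lt ha hmin hj₀ (h1 (by omega)).1 hdp) (h1 (by omega)).2
    · subst hdp
      obtain ⟨u, hu, N', rfl, hN'⟩ := hN.exists_elimination ha hp hmin hj₀ (h1 p.2).2
      refine mul_mem_closure_openOrbit hu (ih _ ?_ hN' rfl)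
      rw [← hn]
      refine Finset.card_lt_card (Finset.ssubset_iff.2 ⟨p, by simp, ?_⟩)
      intro q hq
      rcases Finset.mem_insert.1 hq with rfl | hq
      · simpa using hp
      · simp only [Finset.mem_compl, Finset.mem_insert, not_or] at hq ⊢
        exact hq.2
    · obtain ⟨N', hN'⟩ := hN.exists_degeneration hp hmin hj₀ hdp hdk h0 h1
      -- The inductive hypothesis only puts the perturbed matrices in the closure, so a limit of
      -- limits is taken.
      rw [← closure_closure]
      refine mem_closure_of_eventually_add_smul (N := N') ?_
      filter_upwards [hN'] with s hs
      obtain ⟨hs, q, hqS, hqd, hq⟩ := hs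
      obtain ⟨r, hr, hrmin⟩ := (Finset.univ.filter fun r : Fin k =>
        r ∉ S ∧ (N + s • N') r j₀ ≠ 0).exists_min_image id
          ⟨q, Finset.mem_filter.2 ⟨Finset.mem_univ _, hqS, hq⟩⟩
      simp only [Finset.mem_filter, Finset.mem_univ, true_and, id] at hr hrmin
      have hrq : r ≤ q := hrmin q ⟨hqS, hq⟩
      refine ihd r (lt_of_le_of_lt hrq hqd) _ hs r.2.le ?_ fun _ => hr
      intro t htS htr
      by_contra hne
      exact absurd (hrmin t ⟨htS, hne⟩) (not_le.2 htr)
  by_cases hex : ∃ q ∉ S, M q j₀ ≠ 0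
  · obtain ⟨q, hq⟩ := hex
    obtain ⟨r, hr, hrmin⟩ := (Finset.univ.filter fun r : Fin k =>
      r ∉ S ∧ M r j₀ ≠ 0).exists_min_image id ⟨q, by simpa using hq⟩
    simp only [Finset.mem_filter, Finset.mem_univ, true_and, id] at hr hrmin
    refine main r M hM r.2.le ?_ fun _ => hr
    intro t htS htr
    by_contra hne
    exact absurd (hrmin t ⟨htS, hne⟩) (not_le.2 htr)
  · push Not at hex
    exact main k M hM le_rfl (fun r hr _ => hex r hr) fun h => absurd h (lt_irrefl k)

end Degeneration

/-! ### Passing between matrices and line configurations. -/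

namespace SpanningLineConfig

variable {n k : ℕ}

/-- The matrices whose columns span the lines of a spanning line configuration. -/
def representing (n k : ℕ) : Set (Matrix (Fin k) (Fin n) ℂ) :=
  {M | (∀ j, (fun i => M i j) ≠ 0) ∧ ∃ B : Matrix (Fin n) (Fin k) ℂ, M * B = 1}

theorem iSup_span_col_eq_top_iff {M : Matrix (Fin k) (Fin n) ℂ} :
    ⨆ j, Submodule.span ℂ {fun i => M i j} = ⊤ ↔ ∃ B : Matrix (Fin n) (Fin k) ℂ, M * B = 1 := by
  rw [← Matrix.mulVec_surjective_iff_exists_right_inverse, ← Submodule.span_iUnion,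
    Set.iUnion_singleton_eq_range]
  have : Set.range (fun j i => M i j) = Set.range M.col := rfl
  rw [this, ← Matrix.range_mulVecLin, LinearMap.range_eq_top]
  rfl

/-- The configuration of the lines spanned by the columns of a matrix. -/
def ofMatrix (M : representing n k) : SpanningLineConfig n k :=
  ⟨fun j => Projectivization.mk ℂ (fun i => M.1 i j) (M.2.1 j), by
    rw [← iSup_span_col_eq_top_iff.2 M.2.2]
    exact iSup_congr fun j => Projectivization.submodule_mk _ (M.2.1 j)⟩

theorem isRepresentedBy_ofMatrix (M : representing n k) : (ofMatrix M).IsRepresentedBy M.1 :=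
  fun j => Projectivization.submodule_mk _ (M.2.1 j)

theorem IsRepresentedBy.mem_representing {l : SpanningLineConfig n k}
    {M : Matrix (Fin k) (Fin n) ℂ} (h : l.IsRepresentedBy M) : M ∈ representing n k := by
  constructor
  · intro j hj
    have := (l.1 j).finrank_submodule
    rw [h j, show (fun i => M i j) = 0 from hj, Submodule.span_zero_singleton,
      finrank_bot] at this
    exact zero_ne_one this
  · rw [← iSup_span_col_eq_top_iff, ← l.2]
    exact iSup_congr fun j => (h j).symm

theorem IsRepresentedBy.eq {l l' : SpanningLineConfig n k} {M : Matrix (Fin k) (Fin n) ℂ}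
    (h : l.IsRepresentedBy M) (h' : l'.IsRepresentedBy M) : l = l' :=
  Subtype.ext (funext fun j => Projectivization.submodule_injective ((h j).trans (h' j).symm))

theorem IsRepresentedBy.exists_coord_eq {l : SpanningLineConfig n k}
    {M : Matrix (Fin k) (Fin n) ℂ} (h : l.IsRepresentedBy M) :
    ∃ c : Fin n → ℂ, (∀ j, c j ≠ 0) ∧ ∀ p, l.coord p = c p.2 * M p.1 p.2 := by
  have : ∀ j, ∃ z : ℂˣ, z • (fun i => M i j) = (l.1 j).rep := by
    intro j
    have := h j
    rw [Projectivization.submodule_eq, eq_comm] at this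
    exact Submodule.span_singleton_eq_span_singleton.1 this
  choose z hz using this
  refine ⟨fun j => z j, fun j => (z j).ne_zero, fun p => ?_⟩
  rw [coord, ← hz p.2]
  rfl

theorem IsRepresentedBy.mul_col {l : SpanningLineConfig n k} {M N : Matrix (Fin k) (Fin n) ℂ}
    (h : l.IsRepresentedBy M) {c : Fin n → ℂ} (hc : ∀ j, c j ≠ 0)
    (hN : ∀ i j, N i j = c j * M i j) : l.IsRepresentedBy N := by
  intro j
  rw [h j]
  have : (fun i => N i j) = c j • fun i => M i j := by
    ext i
    simp [hN]
  rw [this, Submodule.span_singleton_smul_eq (isUnit_iff_ne_zero.2 (hc j))]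

theorem eval_mul_col {f : MvPolynomial (Fin k × Fin n) ℂ} {d : Fin n → ℕ}
    (hf : MvPolynomial.IsWeightedHomogeneous
      (fun p : Fin k × Fin n => (Pi.single p.2 1 : Fin n → ℕ)) f d)
    (c : Fin n → ℂ) (x : Fin k × Fin n → ℂ) :
    MvPolynomial.eval (fun p => c p.2 * x p) f = (∏ j, c j ^ d j) * MvPolynomial.eval x f := by
  rw [MvPolynomial.eval_eq', MvPolynomial.eval_eq', Finset.mul_sum]
  refine Finset.sum_congr rfl fun m hm => ?_
  have hd := hf (MvPolynomial.mem_support_iff.1 hm)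
  have hprod : ∏ p : Fin k × Fin n, c p.2 ^ m p = ∏ j, c j ^ d j := by
    rw [Fintype.prod_prod_type_right]
    refine Finset.prod_congr rfl fun j _ => ?_
    refine (Finset.prod_pow_eq_pow_sum Finset.univ (fun i => m (i, j)) (c j)).trans ?_
    rw [← hd, Finsupp.weight_apply, Finsupp.sum_fintype _ _ (by simp)]
    congr 1
    rw [Finset.sum_apply, Fintype.sum_prod_type_right, Finset.sum_eq_single j]
    · simp
    · intro j' _ hj'
      simp [hj']
    · simp
  simp only [mul_pow, Finset.prod_mul_distrib]
  rw [hprod]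
  ring

theorem IsRepresentedBy.eval_coord_ne_zero_iff {l : SpanningLineConfig n k}
    {M : Matrix (Fin k) (Fin n) ℂ} (h : l.IsRepresentedBy M)
    {f : MvPolynomial (Fin k × Fin n) ℂ} (hf : IsMultihomogeneous f) :
    MvPolynomial.eval l.coord f ≠ 0 ↔ MvPolynomial.eval (fun p => M p.1 p.2) f ≠ 0 := by
  obtain ⟨d, hd⟩ := hf
  obtain ⟨c, hc, hlc⟩ := h.exists_coord_eq
  rw [show l.coord = fun p => c p.2 * M p.1 p.2 from funext hlc,
    eval_mul_col hd c fun p => M p.1 p.2]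
  simp [Finset.prod_ne_zero_iff, hc]

/-- The map from matrices to configurations is continuous from the Euclidean topology to the
Zariski topology. -/
theorem continuous_ofMatrix : Continuous (ofMatrix : representing n k → _) := by
  refine continuous_generateFrom_iff.2 ?_
  rintro _ ⟨f, hf, rfl⟩
  have : (ofMatrix : representing n k → _) ⁻¹' {l | MvPolynomial.eval l.coord f ≠ 0} =
      {M | MvPolynomial.eval (fun p : Fin k × Fin n => M.1 p.1 p.2) f ≠ 0} := by
    ext M
    exact (isRepresentedBy_ofMatrix M).eval_coord_ne_zero_iff hf
  rw [this]
  refine isOpen_ne_fun ((MvPolynomial.continuous_eval f).comp ?_) continuous_const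
  exact continuous_pi fun p => (continuous_subtype_val.matrix_elem p.1 p.2)

theorem mem_closure_of_matrix {l : SpanningLineConfig n k} {M : Matrix (Fin k) (Fin n) ℂ}
    (h : l.IsRepresentedBy M) {s : Set (Matrix (Fin k) (Fin n) ℂ)}
    {C : Set (SpanningLineConfig n k)} (hs : ∀ N ∈ s, ∃ l' ∈ C, l'.IsRepresentedBy N)
    (hM : M ∈ closure s) : l ∈ closure C := by
  have hsub : s ⊆ representing n k := by
    intro N hN
    obtain ⟨l', -, hl'⟩ := hs N hN
    exact hl'.mem_representing
  have hl : l = ofMatrix ⟨M, h.mem_representing⟩ :=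
    h.eq (isRepresentedBy_ofMatrix ⟨M, h.mem_representing⟩)
  rw [hl]
  refine map_mem_closure continuous_ofMatrix (s := Subtype.val ⁻¹' s) ?_ ?_
  · rw [closure_subtype, Subtype.image_preimage_coe, Set.inter_eq_right.2 hsub]
    exact hM
  · intro N hN
    obtain ⟨l', hl'C, hl'⟩ := hs N.1 hN
    rwa [(isRepresentedBy_ofMatrix N).eq hl']

/-! ### Top minors as multihomogeneous, `U`-invariant functions. -/

/-- The minor of the top `h` rows in the columns `e`. -/
def topMinor {h : ℕ} (hk : h ≤ k) (e : Fin h → Fin n) (M : Matrix (Fin k) (Fin n) ℂ) : ℂ :=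
  (M.submatrix (Fin.castLE hk) e).det

/-- The polynomial whose values are the minors `topMinor`. -/
def topMinorPoly {h : ℕ} (hk : h ≤ k) (e : Fin h → Fin n) : MvPolynomial (Fin k × Fin n) ℂ :=
  (Matrix.of fun r c => MvPolynomial.X (Fin.castLE hk r, e c)).det

theorem eval_topMinorPoly {h : ℕ} (hk : h ≤ k) (e : Fin h → Fin n)
    (M : Matrix (Fin k) (Fin n) ℂ) :
    MvPolynomial.eval (fun p => M p.1 p.2) (topMinorPoly hk e) = topMinor hk e M := by
  rw [topMinorPoly, RingHom.map_det, topMinor]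
  congr 1
  ext r c
  simp

theorem isMultihomogeneous_topMinorPoly {h : ℕ} (hk : h ≤ k) (e : Fin h → Fin n) :
    IsMultihomogeneous (topMinorPoly (k := k) hk e) := by
  refine ⟨∑ c, Pi.single (e c) 1, ?_⟩
  rw [topMinorPoly, Matrix.det_apply']
  refine MvPolynomial.IsWeightedHomogeneous.sum _ _ _ fun σ _ => ?_
  have hprod := MvPolynomial.IsWeightedHomogeneous.prod Finset.univ
    (fun c => (MvPolynomial.X (Fin.castLE hk (σ c), e c) : MvPolynomial (Fin k × Fin n) ℂ))
    (fun c => (Pi.single (e c) 1 : Fin n → ℕ))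
    (w := fun p : Fin k × Fin n => (Pi.single p.2 1 : Fin n → ℕ))
    fun c _ => MvPolynomial.isWeightedHomogeneous_X ℂ _ _
  have := hprod.C_mul ((Equiv.Perm.sign σ : ℤ) : ℂ)
  simpa using this

/-- A minor that does not vanish at a point of a closure does not vanish identically. -/
theorem exists_topMinor_ne_zero {C : Set (SpanningLineConfig n k)} {l : SpanningLineConfig n k}
    (hl : l ∈ closure C) {M : Matrix (Fin k) (Fin n) ℂ} (hM : l.IsRepresentedBy M) {h : ℕ}
    (hk : h ≤ k) (e : Fin h → Fin n) (hne : topMinor hk e M ≠ 0) :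
    ∃ l' ∈ C, ∀ N, l'.IsRepresentedBy N → topMinor hk e N ≠ 0 := by
  have hf := isMultihomogeneous_topMinorPoly (k := k) hk e
  have hopen : IsOpen {l : SpanningLineConfig n k |
      MvPolynomial.eval l.coord (topMinorPoly hk e) ≠ 0} :=
    TopologicalSpace.isOpen_generateFrom_of_mem ⟨_, hf, rfl⟩
  obtain ⟨l', hl', hl'C⟩ := mem_closure_iff.1 hl _ hopen (by
    rw [← eval_topMinorPoly] at hne
    exact (hM.eval_coord_ne_zero_iff hf).2 hne)
  refine ⟨l', hl'C, fun N hN => ?_⟩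
  rw [← eval_topMinorPoly]
  exact (hN.eval_coord_ne_zero_iff hf).1 hl'

/-- The first `h` rows of `u` vanish beyond column `h`, so the submatrix of the product factors
through the top left block of `u`, which has determinant `1`. -/
theorem topMinor_mul_of_lowerUnitriangular {u : Matrix (Fin k) (Fin k) ℂ}
    (hu : u ∈ lowerUnitriangular k) {h : ℕ} (hk : h ≤ k) (e : Fin h → Fin n)
    (M : Matrix (Fin k) (Fin n) ℂ) : topMinor hk e (u * M) = topMinor hk e M := by
  have hmul : (u * M).submatrix (Fin.castLE hk) e =
      u.submatrix (Fin.castLE hk) (Fin.castLE hk) * M.submatrix (Fin.castLE hk) e := by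
    ext r c
    rw [Matrix.submatrix_apply, Matrix.mul_apply, Matrix.mul_apply]
    symm
    refine Finset.sum_of_injOn (Fin.castLE hk) (Fin.castLE_injective hk).injOn
      (by simp) ?_ (by simp)
    intro q _ hq
    have hhq : h ≤ (q : ℕ) := by
      by_contra hlt
      exact hq ⟨⟨q, not_le.1 hlt⟩, by simp, Fin.ext rfl⟩
    rw [hu.2 _ q (Fin.lt_def.2 (lt_of_lt_of_le r.2 hhq)), zero_mul]
  have hdet : (u.submatrix (Fin.castLE hk) (Fin.castLE hk)).det = 1 := by
    rw [Matrix.det_eq_prod_of_le (a := OrderDual.toDual) OrderDual.toDual.injective]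
    · simp [hu.1]
    · intro i j hij
      by_contra hlt
      exact hij (hu.2 _ _ (by simpa using hlt))
  rw [topMinor, hmul, Matrix.det_mul, hdet, one_mul]
  rfl

end SpanningLineConfig

/-! ### Cells, supported matrices and the minors they allow. -/

namespace FubiniWord

open SpanningLineConfig

variable {n k : ℕ}

theorem apply_alpha (w : FubiniWord n k) (i : Fin k) : w.1 (w.alpha i) = i := by
  exact (Finset.mem_filter.1 ((w.positions i).min'_mem (w.positions_nonempty i))).2

theorem alpha_apply_le (w : FubiniWord n k) (j : Fin n) : w.alpha (w.1 j) ≤ j :=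
  Finset.min'_le _ _ (by simp [positions])

theorem alpha_injective (w : FubiniWord n k) : Function.Injective w.alpha := by
  intro i j h
  rw [← w.apply_alpha i, h, w.apply_alpha]

/-- Matrices whose entries are supported where the letter of the row appears, for the first time,
no later than the letter of the column. -/
def IsSupported (w : FubiniWord n k) (Q : Matrix (Fin k) (Fin n) ℂ) : Prop :=
  ∀ r j, Q r j ≠ 0 → w.alpha r ≤ w.alpha (w.1 j)

theorem isSupported_of_mem_patternMatrices {w : FubiniWord n k} {A : Matrix (Fin k) (Fin n) ℂ}
    (hA : A ∈ w.patternMatrices) : w.IsSupported A := by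
  intro r j hrj
  by_cases hr : r = w.1 j
  · rw [hr]
  · have hstar : w.IsStar r j := by
      by_contra h
      exact hrj ((hA r j).2 hr h)
    obtain ⟨i, ⟨m, rfl⟩, rfl, hlt, -⟩ := hstar
    rw [w.apply_alpha]
    exact hlt.le

/-- The columns at initial positions form a square matrix that is triangular for the order of first
occurrence. -/
theorem exists_mul_eq_one {w : FubiniWord n k} {Q : Matrix (Fin k) (Fin n) ℂ}
    (hQ : w.IsSupported Q) (hd : ∀ j, Q (w.1 j) j ≠ 0) :
    ∃ B : Matrix (Fin n) (Fin k) ℂ, Q * B = 1 := by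
  have hdet : (Q.submatrix id w.alpha).det ≠ 0 := by
    rw [Matrix.det_eq_prod_of_le w.alpha_injective, Finset.prod_ne_zero_iff]
    · intro i _
      simpa [w.apply_alpha] using hd (w.alpha i)
    · intro i j hij
      simpa [w.apply_alpha] using hQ i (w.alpha j) hij
  rw [← Matrix.mulVec_surjective_iff_exists_right_inverse]
  intro x
  have hmul : Q * (1 : Matrix (Fin n) (Fin n) ℂ).submatrix id w.alpha =
      Q.submatrix id w.alpha := by
    ext i j
    simp [Matrix.mul_apply, Matrix.one_apply]
  refine ⟨((1 : Matrix (Fin n) (Fin n) ℂ).submatrix id w.alpha).mulVec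
    ((Q.submatrix id w.alpha)⁻¹.mulVec x), ?_⟩
  rw [Matrix.mulVec_mulVec, Matrix.mulVec_mulVec, hmul,
    Matrix.mul_nonsing_inv _ (isUnit_iff_ne_zero.2 hdet), Matrix.one_mulVec]

/-- The pattern of `w` forbids entries below the `1` in initial columns, which supported matrices
may have. Clearing column `w.alpha p` adds row `p` only to rows whose letter occurs first before `p`
does, so support and the entries at `(w.1 j, j)` survive. -/
theorem exists_clear_initial_columns {w : FubiniWord n k} (h : ℕ) {Q : Matrix (Fin k) (Fin n) ℂ}
    (hQ : w.IsSupported Q) (hd : ∀ j, Q (w.1 j) j ≠ 0) :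
    ∃ u ∈ lowerUnitriangular k, ∃ Q', Q = u * Q' ∧ w.IsSupported Q' ∧ (∀ j, Q' (w.1 j) j ≠ 0) ∧
      ∀ m : Fin k, (m : ℕ) < h → ∀ r, m < r → Q' r (w.alpha m) = 0 := by
  induction h with
  | zero =>
    exact ⟨1, one_mem_lowerUnitriangular, Q, (Matrix.one_mul _).symm,
      hQ, hd, by simp⟩
  | succ h ih =>
    obtain ⟨u, hu, Q', rfl, hQ', hd', hclear⟩ := ih
    by_cases hk : h < k
    · let p : Fin k := ⟨h, hk⟩
      let z : Fin k → ℂ := fun r => if p < r then Q' r (w.alpha p) / Q' p (w.alpha p) else 0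
      have hz : ∀ r ≤ p, z r = 0 := fun r hr => by simp [z, hr.not_gt]
      have hpp : Q' p (w.alpha p) ≠ 0 := by simpa [w.apply_alpha] using hd' (w.alpha p)
      have hzlt : ∀ r, z r ≠ 0 → w.alpha r < w.alpha p := by
        intro r hr
        have hpr : p < r := by
          by_contra hle
          exact hr (hz r (not_lt.1 hle))
        refine lt_of_le_of_ne ?_ fun h => hpr.ne' (w.alpha_injective h)
        have : Q' r (w.alpha p) ≠ 0 := by
          intro h0
          exact hr (by simp [z, h0])
        simpa [w.apply_alpha] using hQ' r _ this
      have happ (r : Fin k) (j : Fin n) : (rowOp p (-z) * Q') r j = Q' r j - z r * Q' p j := by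
        rw [rowOp_mul_apply, Pi.neg_apply]
        ring
      refine ⟨u * rowOp p z, mul_mem_lowerUnitriangular hu (rowOp_mem p hz), rowOp p (-z) * Q',
        ?_, ?_, ?_, ?_⟩
      · rw [Matrix.mul_assoc, ← Matrix.mul_assoc (rowOp p z), rowOp_mul_rowOp_neg p (hz p le_rfl),
          Matrix.one_mul]
      · intro r j hrj
        rw [happ] at hrj
        by_cases h0 : Q' r j = 0
        · have hzr : z r ≠ 0 := fun h => hrj (by simp [h0, h])
          have hpj : Q' p j ≠ 0 := fun h => hrj (by simp [h0, h])
          exact (hzlt r hzr).le.trans (hQ' p j hpj)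
        · exact hQ' r j h0
      · intro j
        rw [happ]
        have : z (w.1 j) * Q' p j = 0 := by
          by_contra hne
          exact (hzlt _ (left_ne_zero_of_mul hne)).not_ge (hQ' p j (right_ne_zero_of_mul hne))
        rw [this, sub_zero]
        exact hd' j
      · intro m hm r hmr
        rw [happ]
        rcases Nat.lt_succ_iff_lt_or_eq.1 hm with hm | hm
        · rw [hclear m hm r hmr, hclear m hm p (Fin.lt_def.2 hm), mul_zero, sub_zero]
        · have : m = p := Fin.ext hm
          subst this
          simp [z, hmr, hpp]
    · exact ⟨u, hu, Q', rfl, hQ', hd', fun m _ => hclear m (by omega)⟩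

/-- The products `u * Q` of the open orbit represent points of the cell. -/
theorem exists_mem_cell {w : FubiniWord n k} {M : Matrix (Fin k) (Fin n) ℂ}
    (hM : M ∈ openOrbit w.alpha w.1) : ∃ l ∈ w.cell, l.IsRepresentedBy M := by
  obtain ⟨u, hu, Q, hQ, hd, rfl⟩ := hM
  obtain ⟨u', hu', Q', rfl, hQ', hd', hclear⟩ := exists_clear_initial_columns k hQ hd
  rw [← Matrix.mul_assoc]
  have huu := mul_mem_lowerUnitriangular hu hu'
  set U := u * u'
  have hU : IsUnit U.det := by
    rw [Matrix.det_eq_prod_of_le (a := OrderDual.toDual) OrderDual.toDual.injective]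
    · simp [huu.1]
    · intro i j hij
      by_contra hlt
      exact hij (huu.2 _ _ (by simpa using hlt))
  have hinj : Function.Injective U.mulVec := Matrix.mulVec_injective_of_isUnit
    ((Matrix.isUnit_iff_isUnit_det U).2 hU)
  have hrep : U * Q' ∈ representing n k := by
    constructor
    · intro j hj
      have : U.mulVec (fun i => Q' i j) = U.mulVec 0 := by
        rw [Matrix.mulVec_zero]
        exact hj
      exact hd' j (congrFun (hinj this) (w.1 j))
    · obtain ⟨B, hB⟩ := exists_mul_eq_one hQ' hd'
      refine ⟨B * U⁻¹, ?_⟩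
      rw [Matrix.mul_assoc, ← Matrix.mul_assoc Q', hB, Matrix.one_mul, Matrix.mul_nonsing_inv _ hU]
  -- Columns are rescaled to have entry `1` at `(w.1 j, j)`; this leaves the lines unchanged.
  refine ⟨ofMatrix ⟨U * Q', hrep⟩, ⟨U, huu, Matrix.of fun r j => (Q' (w.1 j) j)⁻¹ * Q' r j, ?_, ?_⟩,
    isRepresentedBy_ofMatrix _⟩
  · intro r j
    refine ⟨?_, fun hr hstar => ?_⟩
    · rintro rfl
      simp [hd' j]
    · by_contra hne
      have hrj : Q' r j ≠ 0 := by
        intro h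
        exact hne (by simp [h])
      refine hstar ⟨w.alpha r, ⟨r, rfl⟩, w.apply_alpha r,
        lt_of_le_of_ne (hQ' r j hrj) fun h => hr (w.alpha_injective h), ?_⟩
      by_cases hj : j ∈ w.initialPositions
      · refine Or.inl ⟨hj, ?_⟩
        obtain ⟨m, rfl⟩ := hj
        rw [w.apply_alpha] at hr
        rw [w.apply_alpha, w.apply_alpha]
        by_contra hlt
        exact hrj (hclear m m.2 r (lt_of_le_of_ne (not_lt.1 hlt) (Ne.symm hr)))
      · exact Or.inr hj
  · refine (isRepresentedBy_ofMatrix ⟨U * Q', hrep⟩).mul_col (c := fun j => (Q' (w.1 j) j)⁻¹)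
      (fun j => inv_ne_zero (hd' j)) fun i j => ?_
    simp only [Matrix.mul_apply, Matrix.of_apply, Finset.mul_sum]
    exact Finset.sum_congr rfl fun _ _ => by ring

theorem card_filter_lt {h : ℕ} (hk : h ≤ k) :
    (Finset.univ.filter fun i : Fin k => (i : ℕ) < h).card = h := by
  rw [Fin.card_filter_val_lt, min_eq_right hk]

theorem exists_perm_of_topMinor_ne_zero {h : ℕ} {hk : h ≤ k} {e : Fin h → Fin n}
    {M : Matrix (Fin k) (Fin n) ℂ} (hM : topMinor hk e M ≠ 0) :
    ∃ σ : Equiv.Perm (Fin h), ∀ c, M (Fin.castLE hk (σ c)) (e c) ≠ 0 := by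
  rw [topMinor, Matrix.det_apply] at hM
  obtain ⟨σ, -, hσ⟩ := Finset.exists_ne_zero_of_sum_ne_zero hM
  refine ⟨σ, fun c hc => hσ ?_⟩
  have : ∏ i, (M.submatrix (Fin.castLE hk) e) (σ i) i = 0 :=
    Finset.prod_eq_zero (Finset.mem_univ c) hc
  exact (congrArg _ this).trans (smul_zero _)

theorem galeLE_of_topMinor_ne_zero {w : FubiniWord n k} {M : Matrix (Fin k) (Fin n) ℂ}
    (hM : w.IsSupported M) {J : Finset (Fin n)} {hk : J.card ≤ k}
    (hne : topMinor hk (J.orderEmbOfFin rfl) M ≠ 0) :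
    GaleLE (w.alphaInit J.card) (w.alphaSet J) := by
  obtain ⟨σ, hσ⟩ := exists_perm_of_topMinor_ne_zero hne
  refine galeLE_map_of_matching (card_filter_lt hk)
    (fun j => Fin.castLE hk (σ ((J.orderIsoOfFin rfl).symm j))) ?_ fun j => ⟨?_, ?_⟩
  · exact (Fin.castLE_injective hk).comp (σ.injective.comp (OrderIso.injective _))
  · simp
  · have := hM _ _ (hσ ((J.orderIsoOfFin rfl).symm j))
    rwa [← Finset.coe_orderIsoOfFin_apply, OrderIso.apply_symm_apply] at this

theorem topMinor_ne_zero_of_triangular {Λ : Type*} [LinearOrder Λ] {h : ℕ} (hk : h ≤ k)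
    {e : Fin h → Fin n} {M : Matrix (Fin k) (Fin n) ℂ} {τ : Fin h → Fin k}
    (hτ : Function.Injective τ) (hτh : ∀ c, (τ c : ℕ) < h) {b : Fin h → Λ}
    (hb : Function.Injective b) (htri : ∀ i c, M (τ i) (e c) ≠ 0 → b i ≤ b c)
    (hdiag : ∀ c, M (τ c) (e c) ≠ 0) : topMinor hk e M ≠ 0 := by
  have hinj : Function.Injective fun c => (⟨τ c, hτh c⟩ : Fin h) := by
    intro c c' hcc
    exact hτ (Fin.ext (Fin.mk.inj hcc))
  let σ : Equiv.Perm (Fin h) := Equiv.ofBijective _ (Finite.injective_iff_bijective.1 hinj)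
  have hdet := Matrix.det_permute σ (M.submatrix (Fin.castLE hk) e)
  intro h0
  rw [topMinor] at h0
  rw [h0, mul_zero, Matrix.det_eq_prod_of_le hb (by exact htri), Finset.prod_eq_zero_iff] at hdet
  obtain ⟨c, -, hc⟩ := hdet
  exact hdiag c hc

theorem exists_topMinor_ne_zero_of_galeLE {w : FubiniWord n k} {J : Finset (Fin n)}
    (hk : J.card ≤ k) (hJ : GaleLE (w.alphaInit J.card) (w.alphaSet J)) :
    ∃ Q : Matrix (Fin k) (Fin n) ℂ, w.IsSupported Q ∧ (∀ j, Q (w.1 j) j ≠ 0) ∧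
      topMinor hk (J.orderEmbOfFin rfl) Q ≠ 0 := by
  classical
  obtain ⟨e, he, hmem⟩ := GaleLE.exists_matching hJ
  simp only [Finset.mem_filter, Finset.mem_univ, true_and] at hmem
  -- Ones at the required entries and at the matched entries; with the matched rows in decreasing
  -- order of `w.alpha`, the minor is triangular.
  let Q : Matrix (Fin k) (Fin n) ℂ :=
    Matrix.of fun r j => if r = w.1 j ∨ ∃ hj : j ∈ J, r = e ⟨j, hj⟩ then 1 else 0
  have hQ : ∀ r j, Q r j ≠ 0 ↔ r = w.1 j ∨ ∃ hj : j ∈ J, r = e ⟨j, hj⟩ := by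
    intro r j
    simp only [Q, Matrix.of_apply, ne_eq, ite_eq_right_iff, one_ne_zero, imp_false, not_not]
  refine ⟨Q, fun r j hrj => ?_, fun j => (hQ _ _).2 (Or.inl rfl), ?_⟩
  · rcases (hQ r j).1 hrj with rfl | ⟨hj, rfl⟩
    · exact le_rfl
    · exact (hmem ⟨j, hj⟩).2
  · let ε : Fin J.card → J := J.orderIsoOfFin rfl
    have hε : Function.Injective ε := (J.orderIsoOfFin rfl).injective
    have hcoe : ∀ c, J.orderEmbOfFin rfl c = (ε c : Fin n) := fun c =>
      (J.coe_orderIsoOfFin_apply rfl c).symm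
    refine topMinor_ne_zero_of_triangular hk (τ := e ∘ ε) (he.comp hε) (fun c => (hmem _).1)
      (b := OrderDual.toDual ∘ w.alpha ∘ e ∘ ε)
      (OrderDual.toDual.injective.comp (w.alpha_injective.comp (he.comp hε))) ?_ ?_
    · intro i c hic
      rw [hcoe] at hic
      simp only [Function.comp_apply, OrderDual.toDual_le_toDual]
      rcases (hQ _ _).1 hic with h | ⟨hj, h⟩
      · rw [Function.comp_apply] at h
        rw [h]
        exact (hmem (ε c)).2
      · rw [Function.comp_apply] at h
        rw [h]
    · intro c
      rw [hcoe]
      exact (hQ _ _).2 (Or.inr ⟨(ε c).2, rfl⟩)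

/-- Equality forces the letters on `J` to be the first `J.card` letters, each once, so the minor is
triangular with the entries at `(w.1 j, j)` on its diagonal, whatever the other entries are. -/
theorem topMinor_ne_zero_of_alphaInit_eq {w : FubiniWord n k} {M : Matrix (Fin k) (Fin n) ℂ}
    (hM : w.IsSupported M) (hd : ∀ j, M (w.1 j) j ≠ 0) {J : Finset (Fin n)} (hk : J.card ≤ k)
    (hJ : w.alphaInit J.card = w.alphaSet J) : topMinor hk (J.orderEmbOfFin rfl) M ≠ 0 := by
  have hnodup : (w.alphaSet J).Nodup := by
    rw [← hJ]
    exact (Finset.nodup _).map w.alpha_injective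
  have hinj : ∀ i ∈ J, ∀ j ∈ J, w.alpha (w.1 i) = w.alpha (w.1 j) → i = j := fun i hi j hj h =>
    Multiset.inj_on_of_nodup_map hnodup i hi j hj h
  have hlt : ∀ j ∈ J, (w.1 j : ℕ) < J.card := by
    intro j hj
    have hmem : w.alpha (w.1 j) ∈ w.alphaSet J :=
      Multiset.mem_map_of_mem (fun j => w.alpha (w.1 j)) hj
    rw [← hJ] at hmem
    obtain ⟨i, hi, hij⟩ := Multiset.mem_map.1 hmem
    rw [← w.alpha_injective hij]
    simpa using hi
  have hb : Function.Injective fun c => w.alpha (w.1 (J.orderEmbOfFin rfl c)) := fun c c' h =>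
    (J.orderEmbOfFin rfl).injective
      (hinj _ (J.orderEmbOfFin_mem rfl c) _ (J.orderEmbOfFin_mem rfl c') h)
  exact topMinor_ne_zero_of_triangular hk (τ := fun c => w.1 (J.orderEmbOfFin rfl c))
    (b := fun c => w.alpha (w.1 (J.orderEmbOfFin rfl c))) (fun c c' h => hb (congrArg w.alpha h))
    (fun c => hlt _ (J.orderEmbOfFin_mem rfl c)) hb (fun i c hic => hM _ _ hic) fun c => hd _

/-- The matrix with entries `1` at the positions `(w_j, j)` and `0` elsewhere. -/
def wordMatrix (w : FubiniWord n k) : Matrix (Fin k) (Fin n) ℂ :=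
  Matrix.of fun r j => if r = w.1 j then 1 else 0

theorem wordMatrix_ne_zero_iff {w : FubiniWord n k} {r : Fin k} {j : Fin n} :
    w.wordMatrix r j ≠ 0 ↔ r = w.1 j := by
  simp [wordMatrix]

theorem alphaInit_eq_of_topMinor_ne_zero {w : FubiniWord n k} {J : Finset (Fin n)}
    {hk : J.card ≤ k} (hne : topMinor hk (J.orderEmbOfFin rfl) w.wordMatrix ≠ 0) :
    w.alphaInit J.card = w.alphaSet J := by
  obtain ⟨σ, hσ⟩ := exists_perm_of_topMinor_ne_zero hne
  have hσ : ∀ c, Fin.castLE hk (σ c) = w.1 (J.orderEmbOfFin rfl c) := fun c =>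
    wordMatrix_ne_zero_iff.1 (hσ c)
  have hinj : Set.InjOn w.1 J := by
    intro i hi j hj hij
    obtain ⟨c, rfl⟩ : i ∈ Set.range (J.orderEmbOfFin rfl) := by simpa using hi
    obtain ⟨c', rfl⟩ : j ∈ Set.range (J.orderEmbOfFin rfl) := by simpa using hj
    rw [← hσ, ← hσ] at hij
    rw [σ.injective (Fin.castLE_injective hk hij)]
  have himage : J.image w.1 = Finset.univ.filter fun i : Fin k => (i : ℕ) < J.card := by
    refine Finset.eq_of_subset_of_card_le ?_ ?_
    · intro i hi
      obtain ⟨j, hj, rfl⟩ := Finset.mem_image.1 hi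
      obtain ⟨c, rfl⟩ : j ∈ Set.range (J.orderEmbOfFin rfl) := by simpa using hj
      rw [← hσ]
      simp
    · rw [card_filter_lt hk, Finset.card_image_of_injOn hinj]
  rw [alphaInit, ← himage, Finset.image_val_of_injOn hinj, Multiset.map_map]
  rfl

end FubiniWord

/-! ### Membership in the variety and the two criteria. -/

namespace FubiniWord

open SpanningLineConfig Module

variable {n k : ℕ}

/-- If every nonvanishing minor of the top `h` rows satisfies the Gale condition for `v`, then so
do the ranks of the top left blocks. -/
theorem rankBounded_of_topMinor {v : FubiniWord n k} {M : Matrix (Fin k) (Fin n) ℂ}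
    (hB : ∃ B : Matrix (Fin n) (Fin k) ℂ, M * B = 1)
    (hM : ∀ (J : Finset (Fin n)) (hk : J.card ≤ k), topMinor hk (J.orderEmbOfFin rfl) M ≠ 0 →
      GaleLE (v.alphaInit J.card) (v.alphaSet J)) : RankBounded v.alpha v.1 ∅ M := by
  classical
  refine ⟨by simp, by simp, fun h hk m => ?_, hB⟩
  let f : Fin n → Fin h → ℂ := fun j r => M (Fin.castLE hk r) j
  set T : Set (Fin n) := {j | v.alpha (v.1 j) ≤ v.alpha m} with hT
  have htop : Submodule.span ℂ (Set.range f) = ⊤ := by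
    rw [eq_top_iff]
    intro x _
    rw [← Matrix.mulVec_surjective_iff_exists_right_inverse] at hB
    obtain ⟨y, hy⟩ := hB fun r => if hr : (r : ℕ) < h then x ⟨r, hr⟩ else 0
    have hx : x = ∑ j, y j • f j := by
      ext r
      have := congrFun hy (Fin.castLE hk r)
      simp only [Matrix.mulVec, dotProduct, Fin.val_castLE, Fin.is_lt, dite_true, Fin.eta] at this
      rw [← this]
      simp [f, mul_comm]
    rw [hx]
    exact Submodule.sum_mem _ fun j _ =>
      Submodule.smul_mem _ _ (Submodule.subset_span (Set.mem_range_self j))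
  -- A basis of the block's truncated columns, extended to a basis of `ℂ^h`, selects the columns `J`
  -- of a nonzero minor. The block rank is at most the number of elements of `J` in the block, which
  -- the Gale order bounds.
  obtain ⟨b₁, hb₁T, -, hspan₁, hli₁⟩ := exists_linearIndepOn_extension
    (K := ℂ) (v := f) (linearIndepOn_empty ℂ f) (Set.empty_subset T)
  obtain ⟨b₂, -, hb₁₂, hspan₂, hli₂⟩ := exists_linearIndepOn_extension hli₁ (Set.subset_univ b₁)
  have hspan : Submodule.span ℂ (f '' b₂) = ⊤ := by
    rw [eq_top_iff, ← htop, Submodule.span_le, ← Set.image_univ]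
    exact hspan₂
  set J : Finset (Fin n) := b₂.toFinset with hJ
  have hcard : J.card = h := by
    have h1 := finrank_span_eq_card hli₂
    rw [← Set.image_eq_range, hspan, finrank_top, finrank_fin_fun] at h1
    rw [hJ, Set.toFinset_card, ← h1]
  have hrank : finrank ℂ ((colSpan M T).map (coordProj (topRows ∅ h))) ≤ b₁.toFinset.card := by
    let E : (Fin h → ℂ) →ₗ[ℂ] (Fin k → ℂ) :=
      LinearMap.pi fun r => if hr : (r : ℕ) < h then LinearMap.proj ⟨r, hr⟩ else 0
    have hle : (colSpan M T).map (coordProj (topRows ∅ h)) ≤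
        (Submodule.span ℂ (f '' b₁)).map E := by
      rw [map_colSpan_le]
      intro j hj
      refine ⟨f j, hspan₁ ⟨j, hj, rfl⟩, ?_⟩
      ext r
      by_cases hr : (r : ℕ) < h
      · simp [E, f, hr, coordProj_apply, mem_topRows]
      · simp [E, hr, coordProj_apply, mem_topRows]
    refine (Submodule.finrank_mono hle).trans ((Submodule.finrank_map_le _ _).trans ?_)
    have h1 := finrank_span_eq_card hli₁
    rw [← Set.image_eq_range] at h1
    rw [h1, Set.toFinset_card]
  have hminor : topMinor hk (J.orderEmbOfFin hcard) M ≠ 0 := by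
    have hli : LinearIndependent ℂ
        ((M.submatrix (Fin.castLE hk) (J.orderEmbOfFin hcard)).col) := by
      let ε : Fin h → b₂ := fun c => ⟨J.orderEmbOfFin hcard c,
        Set.mem_toFinset.1 (J.orderEmbOfFin_mem hcard c)⟩
      have hε : Function.Injective ε := fun c c' hcc =>
        (J.orderEmbOfFin hcard).injective (Subtype.mk.inj hcc)
      exact hli₂.linearIndependent.comp ε hε
    rw [Matrix.linearIndependent_cols_iff_isUnit, Matrix.isUnit_iff_isUnit_det] at hli
    exact hli.ne_zero
  clear_value J
  subst hcard
  have hG := (galeLE_iff_countP.1 (hM J hk hminor)).2 (v.alpha m)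
  rw [alphaSet, alphaInit, countP_map_val, countP_map_val, Finset.filter_filter] at hG
  refine hrank.trans (le_trans (Finset.card_le_card ?_) (hG.trans (Finset.card_le_card ?_)))
  · intro j hj
    rw [Set.mem_toFinset] at hj
    exact Finset.mem_filter.2 ⟨hJ ▸ Set.mem_toFinset.2 (hb₁₂ hj), hb₁T hj⟩
  · intro r hr
    simpa [mem_topRows] using hr

/-- Membership in the variety of `v` is decided by the nonvanishing top minors. -/
theorem mem_variety_of_topMinor {v : FubiniWord n k} {l : SpanningLineConfig n k}
    {M : Matrix (Fin k) (Fin n) ℂ} (hl : l.IsRepresentedBy M)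
    (hM : ∀ (J : Finset (Fin n)) (hk : J.card ≤ k), 1 ≤ J.card →
      topMinor hk (J.orderEmbOfFin rfl) M ≠ 0 → GaleLE (v.alphaInit J.card) (v.alphaSet J)) :
    l ∈ v.variety := by
  refine mem_closure_of_matrix hl (fun N hN => exists_mem_cell hN)
    ((rankBounded_of_topMinor hl.mem_representing.2 fun J hk hne => ?_).mem_closure_openOrbit
      v.alpha_injective v.2)
  rcases J.card.eq_zero_or_pos with h0 | hpos
  · rw [Finset.card_eq_zero] at h0
    subst h0
    simpa [alphaInit, alphaSet] using GaleLE.refl 0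
  · exact hM J hk hpos hne

theorem galeLE_of_mem_variety {v : FubiniWord n k} {l : SpanningLineConfig n k}
    (hl : l ∈ v.variety) {M : Matrix (Fin k) (Fin n) ℂ} (hM : l.IsRepresentedBy M)
    {J : Finset (Fin n)} (hk : J.card ≤ k) (hne : topMinor hk (J.orderEmbOfFin rfl) M ≠ 0) :
    GaleLE (v.alphaInit J.card) (v.alphaSet J) := by
  obtain ⟨l', ⟨u, hu, A, hA, hrep⟩, hne'⟩ := exists_topMinor_ne_zero hl hM hk _ hne
  have := hne' _ hrep
  rw [topMinor_mul_of_lowerUnitriangular hu] at this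
  exact galeLE_of_topMinor_ne_zero (isSupported_of_mem_patternMatrices hA) this

theorem mem_openOrbit {w : FubiniWord n k} {Q : Matrix (Fin k) (Fin n) ℂ} (hQ : w.IsSupported Q)
    (hd : ∀ j, Q (w.1 j) j ≠ 0) : Q ∈ openOrbit w.alpha w.1 :=
  ⟨1, one_mem_lowerUnitriangular, Q, hQ, hd, (Matrix.one_mul _).symm⟩

theorem mediumRoastLE_iff (v w : FubiniWord n k) :
    v.MediumRoastLE w ↔ ∀ J : Finset (Fin n), 1 ≤ J.card → J.card ≤ k →
      GaleLE (w.alphaInit J.card) (w.alphaSet J) →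
      GaleLE (v.alphaInit J.card) (v.alphaSet J) := by
  constructor
  · intro hvw J _ hk hJ
    obtain ⟨Q, hQ, hd, hne⟩ := exists_topMinor_ne_zero_of_galeLE hk hJ
    obtain ⟨l, hl, hrep⟩ := exists_mem_cell (mem_openOrbit hQ hd)
    exact galeLE_of_mem_variety (hvw hl) hrep hk hne
  · rintro H l ⟨u, hu, A, hA, hrep⟩
    refine mem_variety_of_topMinor hrep fun J hk h1 hne => H J h1 hk ?_
    rw [topMinor_mul_of_lowerUnitriangular hu] at hne
    exact galeLE_of_topMinor_ne_zero (isSupported_of_mem_patternMatrices hA) hne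

/-- The 0/1 matrix of `w` is the least generic point of the cell: its nonzero top minors are nonzero
throughout, so if any point of the cell lies in the variety, this one does. -/
theorem touches_iff (v w : FubiniWord n k) :
    v.Touches w ↔ ∀ J : Finset (Fin n), 1 ≤ J.card → J.card ≤ k →
      w.alphaInit J.card = w.alphaSet J → GaleLE (v.alphaInit J.card) (v.alphaSet J) := by
  constructor
  · rintro ⟨l, hl, u, hu, A, hA, hrep⟩ J _ hk hJ
    refine galeLE_of_mem_variety hl hrep hk ?_
    rw [topMinor_mul_of_lowerUnitriangular hu]
    exact topMinor_ne_zero_of_alphaInit_eq (isSupported_of_mem_patternMatrices hA)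
      (fun j => by simp [(hA _ j).1 rfl]) hk hJ
  · intro H
    have hd : ∀ j, w.wordMatrix (w.1 j) j ≠ 0 := fun j => wordMatrix_ne_zero_iff.2 rfl
    obtain ⟨l, hl, hrep⟩ := exists_mem_cell (mem_openOrbit (Q := w.wordMatrix)
      (fun r j hrj => by rw [wordMatrix_ne_zero_iff.1 hrj]) hd)
    exact ⟨l, mem_variety_of_topMinor hrep fun J hk h1 hne =>
      H J h1 hk (alphaInit_eq_of_topMinor_ne_zero hne), hl⟩

/-! ### The necessary condition and the Ehresmann criterion. -/

/-- The set of the first `h` initial positions. -/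
def initSet (w : FubiniWord n k) (h : ℕ) : Finset (Fin n) :=
  (Finset.univ.filter fun i : Fin k => (i : ℕ) < h).map ⟨w.alpha, w.alpha_injective⟩

theorem card_initSet (w : FubiniWord n k) {h : ℕ} (hk : h ≤ k) : (w.initSet h).card = h := by
  rw [initSet, Finset.card_map, card_filter_lt hk]

theorem alphaSet_initSet (w : FubiniWord n k) (h : ℕ) :
    w.alphaSet (w.initSet h) = w.alphaInit h := by
  rw [alphaSet, initSet, Finset.map_val, Multiset.map_map, alphaInit]
  exact Multiset.map_congr rfl fun i _ => congrArg w.alpha (w.apply_alpha i)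

/-- The first occurrence in `v` of the letter at a position is never to the right of that position.
-/
theorem galeLE_alphaSet_initSet (v w : FubiniWord n k) (h : ℕ) :
    GaleLE (v.alphaSet (w.initSet h)) (w.alphaInit h) := by
  rw [alphaSet, initSet, Finset.map_val, Multiset.map_map, alphaInit]
  exact galeLE_map_of_matching rfl Subtype.val Subtype.val_injective
    fun i => ⟨i.2, v.alpha_apply_le _⟩

/-- For `J = w.initSet h` the hypotheses of both tests hold with equality. -/
theorem galeLE_alphaInit {v w : FubiniWord n k} (hvw : v.MediumRoastLE w ∨ v.Touches w) {h : ℕ}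
    (h1 : 1 ≤ h) (hk : h ≤ k) : GaleLE (v.alphaInit h) (w.alphaInit h) := by
  have hcard := w.card_initSet hk
  refine GaleLE.trans ?_ (galeLE_alphaSet_initSet v w h)
  have key : GaleLE (v.alphaInit (w.initSet h).card) (v.alphaSet (w.initSet h)) := by
    rcases hvw with hvw | hvw
    · refine (mediumRoastLE_iff v w).1 hvw _ (by rwa [hcard]) (by rwa [hcard]) ?_
      rw [hcard, alphaSet_initSet]
      exact GaleLE.refl _
    · refine (touches_iff v w).1 hvw _ (by rwa [hcard]) (by rwa [hcard]) ?_
      rw [hcard, alphaSet_initSet]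
  rwa [hcard] at key

theorem alphaSet_of_injective {w : FubiniWord n k} (hw : Function.Injective w.1)
    (J : Finset (Fin n)) : w.alphaSet J = J.val := by
  conv_rhs => rw [← Multiset.map_id J.val]
  exact Multiset.map_congr rfl fun j _ => hw (w.apply_alpha _)

/-- The Ehresmann criterion for permutations. -/
theorem mediumRoastLE_iff_of_eq (hnk : n = k) (v w : FubiniWord n k) :
    v.MediumRoastLE w ↔ ∀ h : ℕ, 1 ≤ h → h ≤ k → GaleLE (v.alphaInit h) (w.alphaInit h) := by
  refine ⟨fun hvw h h1 hk => galeLE_alphaInit (Or.inl hvw) h1 hk, fun H => ?_⟩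
  rw [mediumRoastLE_iff]
  subst hnk
  intro J h1 hk hJ
  -- For permutations both `α_J` are just `J`, so transitivity of the Gale order concludes.
  rw [alphaSet_of_injective (Finite.injective_iff_surjective.2 w.2)] at hJ
  rw [alphaSet_of_injective (Finite.injective_iff_surjective.2 v.2)]
  exact (H _ h1 hk).trans hJ

end FubiniWord

end

theorem mainTheorem5 (n k : ℕ) (v w : FubiniWord n k) :
    -- the test for the medium roast order
    (v.MediumRoastLE w ↔
      ∀ J : Finset (Fin n), 1 ≤ J.card → J.card ≤ k →
        GaleLE (w.alphaInit J.card) (w.alphaSet J) →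
        GaleLE (v.alphaInit J.card) (v.alphaSet J)) ∧
    -- the test for touching
    (v.Touches w ↔
      ∀ J : Finset (Fin n), 1 ≤ J.card → J.card ≤ k →
        w.alphaInit J.card = w.alphaSet J →
        GaleLE (v.alphaInit J.card) (v.alphaSet J)) ∧
    -- the necessary condition for both relations
    (v.MediumRoastLE w ∨ v.Touches w →
      ∀ h : ℕ, 1 ≤ h → h ≤ k → GaleLE (v.alphaInit h) (w.alphaInit h)) ∧
    -- for permutations, the necessary condition is also sufficient (the Ehresmann Criterion)
    (n = k →
      (v.MediumRoastLE w ↔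
        ∀ h : ℕ, 1 ≤ h → h ≤ k → GaleLE (v.alphaInit h) (w.alphaInit h))) :=
  ⟨v.mediumRoastLE_iff w, v.touches_iff w, fun hvw _ h1 hk => FubiniWord.galeLE_alphaInit hvw h1 hk,
    fun hnk => FubiniWord.mediumRoastLE_iff_of_eq hnk v w⟩
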